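/- Let $\Lambda=\mathbb Z\omega_1+\mathbb Z\omega_2\subset\mathbb C$ be a lattice, $E=\mathbb C/\Lambda$, and let $\wp,\zeta$ be its Weierstrass functions. Let $p_1,\dots,p_N\in\mathbb C$ represent pairwise distinct points of $E$, let $\ell_1,\dots,\ell_N$ be non-negative integers, put $\eta_i=\ell_i/2$, and let $A_1,\dots,A_N,B\in\mathbb C$ with $\sum_i A_i=0$. Consider the generalized Lamé equation on $E$ $$w''=\Big(\sum_{i=1}^N\eta_i(\eta_i+1)\wp(z-p_i)+\sum_{i=1}^N A_i\,\zeta(z-p_i)+B\Big)w .$$ Suppose that all its solutions are free from logarithms, i.e. near every $p_i$ every local solution has the form $(z-p_i)^{-\eta_i}g(z)$ with $g$ holomorphic at $p_i$, and suppose that $\ell=\sum_i\ell_i$ is odd. Fix a base point $x\in E\setminus\{p_1,\dots,p_N\}$ and a fundamental system $w_1,w_2$ of solutions near $x$; analytic continuation along loops based at $x$ in $E\setminus\{p_1,\dots,p_N\}$ assigns to each loop its monodromy matrix in $\mathrm{GL}(2,\mathbb C)$. Let $M\subset \mathrm{GL}(2,\mathbb C)$ be the monodromy group and $PM\subset\mathrm{PGL}(2,\mathbb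 C)$ its image. Then: 1. every loop has exactly one monodromy matrix; 2. the local monodromy around each $p_i$ (along a path from $x$ to a small circle around $p_i$, once around the circle, and back) is $(-1)^{\ell_i}I_2$; 3. if $S_1,S_2$ are the monodromy matrices of loops which represent $\omega_1,\omega_2$ in $\pi_1(E)=\Lambda$, then $S_1S_2=-S_2S_1$; 4. the projective monodromy group $PM$ is isomorphic to the Klein four-group $K_4=\mathbb Z/2\times\mathbb Z/2$. -/

import Mathlib

open scoped Topology unitInterval MatrixGroups

noncomputable section

/-- The Weierstrass zeta function
`ζ(z) = 1 / z + ∑_{l ≠ 0} (1 / (z - l) + 1 / l + z / l ^ 2)` of a period lattice.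
The summand at `l = 0` is `1 / z`, because `1 / 0 = 0` and `z / 0 = 0` in Lean. -/
def PeriodPair.weierstrassZeta (L : PeriodPair) (z : ℂ) : ℂ :=
  ∑' l : L.lattice, (1 / (z - l) + 1 / (l : ℂ) + z / (l : ℂ) ^ 2)

/-- The parameters of a generalized Lamé equation
`w'' = (∑ᵢ ηᵢ (ηᵢ + 1) ℘(z - pᵢ) + ∑ᵢ Aᵢ ζ(z - pᵢ) + B) w`, `ηᵢ = ℓᵢ / 2`, `∑ᵢ Aᵢ = 0`,
where the `pᵢ` represent pairwise distinct points of the torus `ℂ / Λ`. -/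
structure GeneralizedLame where
  /-- the periods `ω₁`, `ω₂` of the lattice `Λ` -/
  L : PeriodPair
  /-- the number of singular points -/
  N : ℕ
  /-- representatives in `ℂ` of the singular points -/
  p : Fin N → ℂ
  /-- the strengths of the singular points -/
  ell : Fin N → ℕ
  /-- the accessory parameters at the singular points -/
  A : Fin N → ℂ
  /-- the constant term of the potential -/
  B : ℂ
  p_distinct : ∀ i j, i ≠ j → p i - p j ∉ L.lattice
  sum_A : ∑ i, A i = 0

namespace GeneralizedLame

variable (D : GeneralizedLame)

/-- The torus `ℂ / Λ`. -/
abbrev Torus : Type := ℂ ⧸ D.L.lattice.toAddSubgroup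

/-- The projection `ℂ → ℂ / Λ`. -/
def proj (z : ℂ) : D.Torus := QuotientAddGroup.mk z

/-- The torus without the singular points. -/
abbrev PuncturedTorus : Type := {x : D.Torus // ∀ i, x ≠ D.proj (D.p i)}

/-- The potential, as a function on `ℂ`. -/
def potential (z : ℂ) : ℂ :=
  ∑ i, ((D.ell i : ℂ) / 2) * ((D.ell i : ℂ) / 2 + 1) * D.L.weierstrassP (z - D.p i)
    + ∑ i, D.A i * D.L.weierstrassZeta (z - D.p i) + D.B

/-- `u` is a holomorphic solution of the equation on the (open) set `U` in the plane. -/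
def SolvesOn (u : ℂ → ℂ) (U : Set ℂ) : Prop :=
  DifferentiableOn ℂ u U ∧ ∀ z ∈ U, deriv (deriv u) z = D.potential z * u z

/-- `u` is a solution in a neighbourhood of the point `z₀` of the plane. -/
def SolvesNear (u : ℂ → ℂ) (z₀ : ℂ) : Prop :=
  ∃ U : Set ℂ, IsOpen U ∧ z₀ ∈ U ∧ D.SolvesOn u U

/-- All solutions are free from logarithms at `pᵢ`: near `pᵢ`, every local solution is
`(z - pᵢ) ^ (-ηᵢ) * g(z)` with `g` holomorphic at `pᵢ`. Here `(z - pᵢ) ^ (-ηᵢ)` is `s ^ (-ℓᵢ)`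
for a local branch `s` of the square root of `z - pᵢ`. -/
def LogFreeAt (i : Fin D.N) : Prop :=
  ∃ r : ℝ, 0 < r ∧ ∀ z₀ ∈ Metric.ball (D.p i) r, z₀ ≠ D.p i →
    ∀ u : ℂ → ℂ, D.SolvesNear u z₀ →
      ∃ s g : ℂ → ℂ, AnalyticAt ℂ s z₀ ∧ (∀ᶠ z in 𝓝 z₀, s z ^ 2 = z - D.p i) ∧
        DifferentiableOn ℂ g (Metric.ball (D.p i) r) ∧
        ∀ᶠ z in 𝓝 z₀, u z = (s z ^ D.ell i)⁻¹ * g z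

/-- All solutions are free from logarithms at all singular points. -/
def LogFree : Prop := ∀ i, D.LogFreeAt i

variable {D}

/-- The function `w` on the torus is a solution near the point `x`: its pull-back to the plane
is a solution on the preimage of a neighbourhood of `x`. -/
def IsSolutionNear (w : D.Torus → ℂ) (x : D.Torus) : Prop :=
  ∃ U : Set D.Torus, IsOpen U ∧ x ∈ U ∧ D.SolvesOn (fun z => w (D.proj z)) (D.proj ⁻¹' U)

/-- `w 0`, `w 1` is a fundamental system of solutions near `x`. -/
def IsFundamentalSystem (w : Fin 2 → D.Torus → ℂ) (x : D.Torus) : Prop :=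
  (∀ k, IsSolutionNear (w k) x) ∧
    ∀ c : Fin 2 → ℂ, (∀ᶠ y in 𝓝 x, ∑ k, c k * w k y = 0) → c = 0

/-- `W` is an analytic continuation, through solutions of the equation, along the path `γ`:
`W t` is a function element at `γ t`, and for `s` near `t` the elements `W s` and `W t`
have the same germ at `γ s`. -/
def IsContinuation {x y : D.PuncturedTorus} (γ : Path x y) (W : I → D.Torus → ℂ) : Prop :=
  (∀ t, IsSolutionNear (W t) (γ t).1) ∧ ∀ t, ∀ᶠ s in 𝓝 t, W s =ᶠ[𝓝 (γ s).1] W t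

/-- `g` is the monodromy matrix of the loop `γ` in the fundamental system `w`:
analytic continuation along `γ` takes `w j` to `∑ k, g k j * w k`. -/
def IsMonodromyMatrix {x : D.PuncturedTorus} (w : Fin 2 → D.Torus → ℂ) (γ : Path x x)
    (g : GL (Fin 2) ℂ) : Prop :=
  ∀ j, ∃ W : I → D.Torus → ℂ, IsContinuation γ W ∧ W 0 =ᶠ[𝓝 x.1] w j ∧
    W 1 =ᶠ[𝓝 x.1] fun y => ∑ k, g.val k j * w k y

/-- The monodromy group `M`, formed by the monodromy matrices of all loops based at `x` in the
punctured torus. (These matrices already form a group, since loops can be concatenated and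
reversed.) -/
def monodromyGroup (x : D.PuncturedTorus) (w : Fin 2 → D.Torus → ℂ) : Subgroup (GL (Fin 2) ℂ) :=
  Subgroup.closure {g | ∃ γ : Path x x, IsMonodromyMatrix w γ g}

/-- The projective monodromy group `PM`, the image of `M` in `PGL(2, ℂ)`. -/
def projectiveMonodromyGroup (x : D.PuncturedTorus) (w : Fin 2 → D.Torus → ℂ) :
    Subgroup PGL(2, ℂ) :=
  (monodromyGroup x w).map Matrix.ProjGenLinGroup.mk

/-- The loop `c` is a positively oriented circle around `pᵢ`, so small that the closed disc that
it bounds in the plane contains no other point which lies over a singular point. -/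
def IsSmallCircle (i : Fin D.N) {x : D.PuncturedTorus} (c : Path x x) : Prop :=
  ∃ r : ℝ, 0 < r ∧
    (∀ z ∈ Metric.closedBall (D.p i) r, (∃ j, D.proj z = D.proj (D.p j)) → z = D.p i) ∧
    ∀ t : I, (c t).1 = D.proj (D.p i + r * Complex.exp (2 * Real.pi * Complex.I * (t : ℝ)))

/-- The loop `γ` represents the period `ω` in `π₁(ℂ / Λ) = Λ`: it lifts to a path in the plane
with end point minus starting point equal to `ω`. -/
def RepresentsPeriod {x : D.PuncturedTorus} (γ : Path x x) (ω : ℂ) : Prop :=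
  ∃ γ' : C(I, ℂ), (∀ t, D.proj (γ' t) = (γ t).1) ∧ γ' 1 = γ' 0 + ω

end GeneralizedLame

end

/-! A square root of a theta product carries all the multivaluedness of the solutions. Let Ψ be the
product of the Θ(z - pᵢ) ^ ℓᵢ, where Θ is an entire theta function with simple zeros on Λ. Then Ψ is
ω₁-periodic, and Ψ(z + ω₂) = exp(a z + b) Ψ(z) with a ω₁ = ±2πiℓ (`exists_isDivisorFunction`). If w
solves the Lamé equation, then h = w √Ψ solves a second-order linear equation with single-valued
coefficients (`goodAt_mul`). At a singular point w = (z - pᵢ) ^ (-ℓᵢ/2) g, and √Ψ supplies the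
inverse of the fractional power, so h is holomorphic there. Hence every germ h extends to an entire
function (`exists_entire_extension`), and these entire functions form a two-dimensional space
(`exists_isGoodBasis`).

The potential is Λ-periodic because ∑ Aᵢ = 0. So translation by l ∈ Λ, divided by a square root of
the multiplier of Ψ, acts on this space by a matrix that is determined up to sign (`exists_actsBy`,
`eq_or_eq_neg_of_actsBy`). The monodromy along a loop whose lift has displacement l is one of these
two matrices; continuation of √Ψ along the lift selects the sign (`isMonodromyMatrix_of_actsBy`). A
small circle around pᵢ has displacement 0 and changes √Ψ by (-1) ^ ℓᵢ, which gives the local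
monodromy.

The translations by ω₁ and ω₂ commute, but the square roots of their multipliers, composed in the
two orders, differ by exp(a ω₁ / 2) = (-1) ^ ℓ = -1. Hence S₁S₂ = -S₂S₁ (`anticommute_of_actsBy`).
Anticommuting invertible 2 × 2 matrices have scalar squares, so S₁ and S₂ become distinct commuting
involutions in PGL(2, ℂ). They generate PM, since every monodromy matrix is ±S₁ᵐS₂ⁿ. -/

noncomputable section

/-! ### Local theory of the equation u'' = V u: power series and Wronskians. -/

/-- A power series with geometrically bounded coefficients may be differentiated term by term. -/
lemma powerSeries_differentiableOn_deriv {c : ℕ → ℂ} {C K : ℝ} (hK : 0 < K)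
    (hc : ∀ n, ‖c n‖ ≤ C * K ^ n) (z₀ : ℂ) :
    DifferentiableOn ℂ (fun z => ∑' n, c n * (z - z₀) ^ n) (Metric.ball z₀ (1 / (2 * K))) ∧
      ∀ z ∈ Metric.ball z₀ (1 / (2 * K)),
        deriv (fun z => ∑' n, c n * (z - z₀) ^ n) z =
          ∑' n, ((n + 1) * c (n + 1)) * (z - z₀) ^ n := by
  -- On the disc of radius 1 / (2K) the n-th term is at most C (1/2) ^ n.
  have hu : Summable fun n : ℕ => C * (1 / 2 : ℝ) ^ n :=
    (summable_geometric_of_lt_one (by norm_num) (by norm_num)).mul_left C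
  have hd : ∀ n : ℕ, DifferentiableOn ℂ (fun z : ℂ => c n * (z - z₀) ^ n)
      (Metric.ball z₀ (1 / (2 * K))) := fun n => by fun_prop
  have hb : ∀ n : ℕ, ∀ z ∈ Metric.ball z₀ (1 / (2 * K)),
      ‖c n * (z - z₀) ^ n‖ ≤ C * (1 / 2 : ℝ) ^ n := by
    intro n z hz
    rw [norm_mul, norm_pow]
    have h1 : ‖z - z₀‖ ≤ 1 / (2 * K) := by
      rw [← dist_eq_norm]; exact (Metric.mem_ball.mp hz).le
    calc ‖c n‖ * ‖z - z₀‖ ^ n ≤ (C * K ^ n) * (1 / (2 * K)) ^ n :=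
          mul_le_mul (hc n) (pow_le_pow_left₀ (norm_nonneg _) h1 n) (by positivity)
            ((norm_nonneg _).trans (hc n))
      _ = C * (1 / 2 : ℝ) ^ n := by
          rw [mul_assoc, ← mul_pow]; congr 2; field_simp
  refine ⟨Complex.differentiableOn_tsum_of_summable_norm hu hd Metric.isOpen_ball hb,
    fun z hz => ?_⟩
  have h := Complex.hasSum_deriv_of_summable_norm hu hd Metric.isOpen_ball hb hz
  have hderiv : ∀ n : ℕ, deriv (fun z : ℂ => c n * (z - z₀) ^ n) z
      = c n * (n * (z - z₀) ^ (n - 1)) := by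
    intro n
    simp
  simp only [hderiv] at h
  rw [← h.tsum_eq, h.summable.tsum_eq_zero_add]
  simp only [Nat.cast_zero, zero_mul, mul_zero, zero_add, Nat.add_sub_cancel, Nat.cast_add,
    Nat.cast_one]
  exact tsum_congr fun n => by ring

/-- `u` is a holomorphic solution of `u'' = V u` on `U`. -/
def SolvesLinear (V u : ℂ → ℂ) (U : Set ℂ) : Prop :=
  DifferentiableOn ℂ u U ∧ ∀ z ∈ U, deriv (deriv u) z = V z * u z

/-- The Taylor coefficients of a solution of `u'' = V u`, where `V` has Taylor coefficients `a`. -/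
def odeCoeff (a : ℕ → ℂ) (x y : ℂ) : ℕ → ℂ
  | 0 => x
  | 1 => y
  | n + 2 => (∑ k : Fin (n + 1), a (n - k) * odeCoeff a x y k) / ((n + 1) * (n + 2))
decreasing_by have := k.2; omega

lemma odeCoeff_add_two (a : ℕ → ℂ) (x y : ℂ) (n : ℕ) :
    ((n : ℂ) + 1) * ((n + 2) * odeCoeff a x y (n + 2)) =
      ∑ k ∈ Finset.range (n + 1), a (n - k) * odeCoeff a x y k := by
  rw [odeCoeff, Finset.sum_range]
  have h1 : (n : ℂ) + 1 ≠ 0 := by exact_mod_cast n.succ_ne_zero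
  have h2 : (n : ℂ) + 2 ≠ 0 := by exact_mod_cast (n + 1).succ_ne_zero
  field_simp

/-- Each of the n + 1 terms in the recursion is at most M (‖x‖ + ‖y‖) K ^ n. The factor n + 1
cancels against the denominator, n + 2 is dropped, and M ≤ K ^ 2 supplies the two missing powers of
K. -/
lemma norm_odeCoeff_le {a : ℕ → ℂ} {M K : ℝ} (hK : 1 ≤ K) (hM : M ≤ K ^ 2)
    (ha : ∀ n, ‖a n‖ ≤ M * K ^ n) (x y : ℂ) (n : ℕ) :
    ‖odeCoeff a x y n‖ ≤ (‖x‖ + ‖y‖) * K ^ n := by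
  have hM0 : 0 ≤ M := by simpa using (norm_nonneg _).trans (ha 0)
  induction n using Nat.strong_induction_on with
  | _ n ih =>
    match n, ih with
    | 0, _ => simp [odeCoeff]
    | 1, _ =>
      simp only [odeCoeff, pow_one]
      nlinarith [norm_nonneg x, norm_nonneg y]
    | n + 2, ih =>
      have h1 : (0 : ℝ) < (n : ℝ) + 1 := by positivity
      have h2 : (1 : ℝ) ≤ (n : ℝ) + 2 := by linarith
      have hs := odeCoeff_add_two a x y n
      have hs' := congrArg norm hs
      rw [norm_mul, norm_mul] at hs'
      have e1 : ‖(n : ℂ) + 1‖ = (n : ℝ) + 1 := by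
        rw [← Nat.cast_one, ← Nat.cast_add, Complex.norm_natCast]; push_cast; ring
      have e2 : ‖(n : ℂ) + 2‖ = (n : ℝ) + 2 := by
        have : (n : ℂ) + 2 = ((n + 2 : ℕ) : ℂ) := by push_cast; ring
        rw [this, Complex.norm_natCast]; push_cast; ring
      rw [e1, e2] at hs'
      have hle : ‖∑ k ∈ Finset.range (n + 1), a (n - k) * odeCoeff a x y k‖ ≤
          (n + 1) * (M * (‖x‖ + ‖y‖) * K ^ n) := by
        calc _ ≤ ∑ k ∈ Finset.range (n + 1), ‖a (n - k) * odeCoeff a x y k‖ := norm_sum_le _ _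
          _ ≤ ∑ k ∈ Finset.range (n + 1), M * (‖x‖ + ‖y‖) * K ^ n := by
              refine Finset.sum_le_sum fun k hk => ?_
              have hk' : k < n + 1 := Finset.mem_range.mp hk
              rw [norm_mul]
              calc _ ≤ (M * K ^ (n - k)) * ((‖x‖ + ‖y‖) * K ^ k) :=
                    mul_le_mul (ha _) (ih k (by omega)) (norm_nonneg _) (by positivity)
                _ = M * (‖x‖ + ‖y‖) * (K ^ (n - k) * K ^ k) := by ring
                _ = _ := by rw [← pow_add, Nat.sub_add_cancel (by omega)]
          _ = _ := by simp
      set q := ‖odeCoeff a x y (n + 2)‖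
      have hq : 0 ≤ q := norm_nonneg _
      have h3 : (n + 1 : ℝ) * ((n + 2) * q) ≤ (n + 1) * (M * (‖x‖ + ‖y‖) * K ^ n) := hs' ▸ hle
      have h4 := le_of_mul_le_mul_left h3 h1
      have h5 : q ≤ (n + 2) * q := by nlinarith
      calc q ≤ M * (‖x‖ + ‖y‖) * K ^ n := h5.trans h4
        _ ≤ K ^ 2 * (‖x‖ + ‖y‖) * K ^ n := by gcongr
        _ = _ := by ring

/-- Local existence for the equation `u'' = V u`. -/
theorem exists_solvesLinear {V : ℂ → ℂ} {z₀ : ℂ} (hV : AnalyticAt ℂ V z₀) :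
    ∃ r > 0, ∀ x y : ℂ, ∃ u, SolvesLinear V u (Metric.ball z₀ r) ∧ u z₀ = x ∧ deriv u z₀ = y := by
  obtain ⟨p, hp⟩ := hV
  obtain ⟨M, ρ, hM, hρ, hb⟩ := p.le_mul_pow_of_radius_pos hp.radius_pos
  have hV' := hasFPowerSeriesAt_iff.mp hp
  obtain ⟨ε, hε, hVε⟩ := Metric.eventually_nhds_iff.mp hV'
  set a : ℕ → ℂ := p.coeff with ha_def
  -- This K dominates the growth rate ρ, and K ≥ 1 with K ≥ M gives M ≤ K ^ 2.
  set K : ℝ := max (max 1 ρ) M with hKdef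
  have hK1 : 1 ≤ K := (le_max_left _ _).trans (le_max_left _ _)
  have hKρ : ρ ≤ K := (le_max_right _ _).trans (le_max_left _ _)
  have hKM : M ≤ K ^ 2 := (le_max_right _ _).trans (by nlinarith)
  have hK0 : 0 < K := by linarith
  have ha : ∀ n, ‖a n‖ ≤ M * K ^ n := fun n => by
    rw [ha_def, ← FormalMultilinearSeries.norm_apply_eq_norm_coef]
    exact (hb n).trans (by gcongr)
  -- The coefficients (n + 1) c (n + 1) of the derivative grow at rate 2K, because n + 1 ≤ 2 ^ n;
  -- differentiating the series twice therefore requires the radius 1 / (2 · 2K). The bound ε keeps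
  -- z where V equals its Taylor series.
  refine ⟨min ε (1 / (2 * (2 * K))), by positivity, fun x y => ?_⟩
  set c := odeCoeff a x y with hc_def
  set C := ‖x‖ + ‖y‖ with hC
  have hc : ∀ n, ‖c n‖ ≤ C * K ^ n := norm_odeCoeff_le hK1 hKM ha x y
  have hc' : ∀ n : ℕ, ‖((n : ℂ) + 1) * c (n + 1)‖ ≤ (C * K) * (2 * K) ^ n := by
    intro n
    have e1 : ‖(n : ℂ) + 1‖ = (n : ℝ) + 1 := by
      rw [← Nat.cast_one, ← Nat.cast_add, Complex.norm_natCast]; push_cast; ring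
    have e2 : (n : ℝ) + 1 ≤ 2 ^ n := by exact_mod_cast n.lt_two_pow_self
    rw [norm_mul, e1]
    calc ((n : ℝ) + 1) * ‖c (n + 1)‖ ≤ 2 ^ n * (C * K ^ (n + 1)) :=
          mul_le_mul e2 (hc _) (norm_nonneg _) (by positivity)
      _ = _ := by rw [mul_pow]; ring
  obtain ⟨d1, d2⟩ := powerSeries_differentiableOn_deriv hK0 hc z₀
  obtain ⟨d3, d4⟩ := powerSeries_differentiableOn_deriv (by positivity) hc' z₀
  have hsub : Metric.ball z₀ (1 / (2 * (2 * K))) ⊆ Metric.ball z₀ (1 / (2 * K)) :=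
    Metric.ball_subset_ball (by gcongr; linarith)
  have hsub' : Metric.ball z₀ (min ε (1 / (2 * (2 * K)))) ⊆ Metric.ball z₀ (1 / (2 * (2 * K))) :=
    Metric.ball_subset_ball (min_le_right _ _)
  refine ⟨fun z => ∑' n, c n * (z - z₀) ^ n, ⟨d1.mono (hsub'.trans hsub), fun z hz => ?_⟩, ?_, ?_⟩
  · have hz2 := hsub' hz
    have hev : deriv (fun z => ∑' n, c n * (z - z₀) ^ n) =ᶠ[𝓝 z]
        fun z => ∑' n : ℕ, (((n : ℂ) + 1) * c (n + 1)) * (z - z₀) ^ n := by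
      filter_upwards [Metric.isOpen_ball.mem_nhds hz2] with w hw using d2 w (hsub hw)
    rw [hev.deriv_eq, d4 z hz2]
    have hzε : dist (z - z₀) 0 < ε := by
      rw [dist_zero_right, ← dist_eq_norm]
      exact (Metric.mem_ball.mp hz).trans_le (min_le_left _ _)
    have hsumV := hVε hzε
    simp only [smul_eq_mul, add_sub_cancel] at hsumV
    have hzK : K * ‖z - z₀‖ ≤ 1 / 2 := by
      have : ‖z - z₀‖ < 1 / (2 * K) := by
        rw [← dist_eq_norm]; exact Metric.mem_ball.mp (hsub hz2)
      rw [lt_div_iff₀ (by positivity)] at this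
      linarith
    have hsummable : ∀ (f : ℕ → ℂ) (B : ℝ), (∀ n, ‖f n‖ ≤ B * K ^ n) →
        Summable fun n => ‖f n * (z - z₀) ^ n‖ := by
      intro f B hf
      refine Summable.of_nonneg_of_le (fun _ => norm_nonneg _) (fun n => ?_)
        ((summable_geometric_of_lt_one (r := (1 / 2 : ℝ)) (by norm_num) (by norm_num)).mul_left B)
      have hB : 0 ≤ B := by simpa using (norm_nonneg _).trans (hf 0)
      rw [norm_mul, norm_pow]
      calc _ ≤ (B * K ^ n) * ‖z - z₀‖ ^ n := by gcongr; exact hf n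
        _ = B * (K * ‖z - z₀‖) ^ n := by rw [mul_pow]; ring
        _ ≤ _ := by gcongr
    have hVz : V z = ∑' n, a n * (z - z₀) ^ n := by
      rw [← hsumV.tsum_eq]; exact tsum_congr fun n => mul_comm _ _
    rw [hVz, mul_comm, tsum_mul_tsum_eq_tsum_sum_range_of_summable_norm (hsummable c C hc)
      (hsummable a M ha)]
    refine tsum_congr fun n => ?_
    have hrec := odeCoeff_add_two a x y n
    have : (∑ k ∈ Finset.range (n + 1), c k * (z - z₀) ^ k * (a (n - k) * (z - z₀) ^ (n - k)))
        = (∑ k ∈ Finset.range (n + 1), a (n - k) * c k) * (z - z₀) ^ n := by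
      rw [Finset.sum_mul]
      refine Finset.sum_congr rfl fun k hk => ?_
      have hk' : k < n + 1 := Finset.mem_range.mp hk
      rw [← Nat.add_sub_of_le (show k ≤ n by omega), pow_add, Nat.add_sub_cancel_left]
      ring
    rw [this, ← hrec]
    push_cast
    ring
  · show ∑' n, c n * (z₀ - z₀) ^ n = x
    rw [tsum_eq_single 0 fun n hn => by simp [hn]]
    simp [hc_def, odeCoeff]
  · rw [d2 z₀ (Metric.mem_ball_self (by positivity)), tsum_eq_single 0 fun n hn => by simp [hn]]
    simp [hc_def, odeCoeff]

namespace SolvesLinear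

variable {V u v : ℂ → ℂ} {U U' : Set ℂ}

lemma mono (h : SolvesLinear V u U) (hU : U' ⊆ U) : SolvesLinear V u U' :=
  ⟨h.1.mono hU, fun z hz => h.2 z (hU hz)⟩

lemma congr (h : SolvesLinear V u U) (hU : IsOpen U) (huv : Set.EqOn v u U) :
    SolvesLinear V v U := by
  refine ⟨h.1.congr huv, fun z hz => ?_⟩
  have : v =ᶠ[𝓝 z] u := by filter_upwards [hU.mem_nhds hz] with w hw using huv hw
  rw [this.deriv.deriv_eq, this.eq_of_nhds, h.2 z hz]

lemma hasDerivAt (h : SolvesLinear V u U) (hU : IsOpen U) {z : ℂ} (hz : z ∈ U) :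
    HasDerivAt u (deriv u z) z :=
  (h.1.differentiableAt (hU.mem_nhds hz)).hasDerivAt

lemma hasDerivAt_deriv (h : SolvesLinear V u U) (hU : IsOpen U) {z : ℂ} (hz : z ∈ U) :
    HasDerivAt (deriv u) (V z * u z) z := by
  rw [← h.2 z hz]
  exact ((h.1.deriv hU).differentiableAt (hU.mem_nhds hz)).hasDerivAt

lemma of_hasDerivAt {u' : ℂ → ℂ} (hU : IsOpen U) (h : ∀ z ∈ U, HasDerivAt u (u' z) z)
    (h' : ∀ z ∈ U, HasDerivAt u' (V z * u z) z) : SolvesLinear V u U := by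
  refine ⟨fun z hz => (h z hz).differentiableAt.differentiableWithinAt, fun z hz => ?_⟩
  have : deriv u =ᶠ[𝓝 z] u' := by filter_upwards [hU.mem_nhds hz] with w hw using (h w hw).deriv
  rw [this.deriv_eq, (h' z hz).deriv]

lemma lincomb (hu : SolvesLinear V u U) (hv : SolvesLinear V v U) (hU : IsOpen U) (a b : ℂ) :
    SolvesLinear V (fun z => a * u z + b * v z) U :=
  of_hasDerivAt hU
    (fun _ hz => ((hu.hasDerivAt hU hz).const_mul a).add ((hv.hasDerivAt hU hz).const_mul b))
    (fun _ hz => (((hu.hasDerivAt_deriv hU hz).const_mul a).add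
      ((hv.hasDerivAt_deriv hU hz).const_mul b)).congr_deriv (by ring))

/-- The Wronskian of two solutions is constant. -/
lemma exists_wronskian_eq (hu : SolvesLinear V u U) (hv : SolvesLinear V v U) (hU : IsOpen U)
    (hUc : IsPreconnected U) : ∃ c, ∀ z ∈ U, u z * deriv v z - deriv u z * v z = c := by
  have hd : ∀ z ∈ U, HasDerivAt (fun z => u z * deriv v z - deriv u z * v z) 0 z := fun z hz =>
    (((hu.hasDerivAt hU hz).mul (hv.hasDerivAt_deriv hU hz)).sub
      ((hu.hasDerivAt_deriv hU hz).mul (hv.hasDerivAt hU hz))).congr_deriv (by ring)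
  exact hU.exists_is_const_of_deriv_eq_zero hUc
    (fun z hz => (hd z hz).differentiableAt.differentiableWithinAt) fun z hz => (hd z hz).deriv

/-- Every solution is a linear combination of two solutions with non-vanishing Wronskian. -/
lemma exists_eq_lincomb {u₁ u₂ : ℂ → ℂ} (hu : SolvesLinear V u U) (hU : IsOpen U)
    (hUc : IsPreconnected U) (h₁ : SolvesLinear V u₁ U) (h₂ : SolvesLinear V u₂ U) {z₀ : ℂ}
    (hz₀ : z₀ ∈ U) (hW : u₁ z₀ * deriv u₂ z₀ - deriv u₁ z₀ * u₂ z₀ ≠ 0) :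
    ∃ a b, ∀ z ∈ U, u z = a * u₁ z + b * u₂ z := by
  obtain ⟨W, hWc⟩ := h₁.exists_wronskian_eq h₂ hU hUc
  obtain ⟨a, ha⟩ := hu.exists_wronskian_eq h₂ hU hUc
  obtain ⟨b, hb⟩ := h₁.exists_wronskian_eq hu hU hUc
  rw [hWc z₀ hz₀] at hW
  -- Cramer's rule: W(u₁, u₂) u = W(u, u₂) u₁ + W(u₁, u) u₂ with constant Wronskians.
  refine ⟨a / W, b / W, fun z hz => ?_⟩
  field_simp
  rw [← ha z hz, ← hb z hz, ← hWc z hz]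
  ring

end SolvesLinear

/-- Near a point where `V` is analytic, there are two solutions of `u'' = V u` such that every
solution on a smaller disc is a linear combination of them. -/
theorem exists_solvesLinear_basis {V : ℂ → ℂ} {z₀ : ℂ} (hV : AnalyticAt ℂ V z₀) :
    ∃ r > 0, ∃ u₁ u₂ : ℂ → ℂ, SolvesLinear V u₁ (Metric.ball z₀ r) ∧
      SolvesLinear V u₂ (Metric.ball z₀ r) ∧
      ∀ z ∈ Metric.ball z₀ r, u₁ z * deriv u₂ z - deriv u₁ z * u₂ z = 1 := by
  obtain ⟨r, hr, h⟩ := exists_solvesLinear hV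
  obtain ⟨u₁, h₁, h₁0, h₁1⟩ := h 1 0
  obtain ⟨u₂, h₂, h₂0, h₂1⟩ := h 0 1
  obtain ⟨c, hc⟩ := h₁.exists_wronskian_eq h₂ Metric.isOpen_ball
    (convex_ball _ _).isPreconnected
  have h0 := hc z₀ (Metric.mem_ball_self hr)
  rw [h₁0, h₁1, h₂0, h₂1] at h0
  exact ⟨r, hr, u₁, u₂, h₁, h₂, fun z hz => by rw [hc z hz, ← h0]; ring⟩

/-- A solution with vanishing initial values vanishes. -/
theorem SolvesLinear.eventually_eq_zero {V u : ℂ → ℂ} {U : Set ℂ} {z₀ : ℂ}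
    (hV : AnalyticAt ℂ V z₀) (hU : U ∈ 𝓝 z₀) (hu : SolvesLinear V u U) (h0 : u z₀ = 0)
    (h1 : deriv u z₀ = 0) : ∀ᶠ z in 𝓝 z₀, u z = 0 := by
  obtain ⟨r, hr, u₁, u₂, h₁, h₂, hW⟩ := exists_solvesLinear_basis hV
  obtain ⟨ε, hε, hεU⟩ := Metric.mem_nhds_iff.mp hU
  set ρ := min r ε
  have hρ : 0 < ρ := lt_min hr hε
  have hs₁ : Metric.ball z₀ ρ ⊆ Metric.ball z₀ r := Metric.ball_subset_ball (min_le_left _ _)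
  have hs₂ : Metric.ball z₀ ρ ⊆ U := (Metric.ball_subset_ball (min_le_right _ _)).trans hεU
  have hm : z₀ ∈ Metric.ball z₀ ρ := Metric.mem_ball_self hρ
  -- The Wronskians of `u` with `u₁` and `u₂` are constant and vanish at z₀. Then u W(u₁, u₂) = u₁
  -- W(u, u₂) - u₂ W(u, u₁) forces u = 0.
  obtain ⟨a, ha⟩ := (hu.mono hs₂).exists_wronskian_eq (h₁.mono hs₁) Metric.isOpen_ball
    (convex_ball _ _).isPreconnected
  obtain ⟨b, hb⟩ := (hu.mono hs₂).exists_wronskian_eq (h₂.mono hs₁) Metric.isOpen_ball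
    (convex_ball _ _).isPreconnected
  have ha0 := ha z₀ hm
  have hb0 := hb z₀ hm
  simp only [h0, h1, zero_mul, sub_zero] at ha0 hb0
  filter_upwards [Metric.ball_mem_nhds z₀ hρ] with z hz
  have e1 := ha z hz
  have e2 := hb z hz
  have e3 := hW z (hs₁ hz)
  rw [← ha0] at e1
  rw [← hb0] at e2
  linear_combination (-u z) * e3 + u₁ z * e2 - u₂ z * e1

end

/-! ### The theta function of a lattice, as an infinite product. -/

noncomputable section

/-- The `q`-Pochhammer product `∏ (1 - q ^ n x)`. -/
def qProd (q x : ℂ) : ℂ := ∏' n : ℕ, (1 + -(q ^ n * x))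

section qProd

variable {q : ℂ} (hq : ‖q‖ < 1)

include hq

lemma differentiable_qProd : Differentiable ℂ (qProd q) := by
  have h : ∀ R : ℝ, DifferentiableOn ℂ (qProd q) (Metric.ball 0 R) := by
    intro R
    have hs : Summable fun n : ℕ => ‖q‖ ^ n * R :=
      (summable_geometric_of_lt_one (norm_nonneg _) hq).mul_right R
    have := Summable.hasProdLocallyUniformlyOn_nat_one_add
      (f := fun n x => -(q ^ n * x)) (K := Metric.ball (0 : ℂ) R) Metric.isOpen_ball hs
      (.of_forall fun n x hx => by
        rw [norm_neg, norm_mul, norm_pow]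
        gcongr
        simpa using (Metric.mem_ball.mp hx).le) (fun n => by fun_prop)
    exact this.differentiableOn (.of_forall fun s => by
      simpa [Finset.prod_fn] using DifferentiableOn.finsetProd (fun _ _ => by fun_prop))
      Metric.isOpen_ball
  intro x
  exact (h (‖x‖ + 1)).differentiableAt (Metric.isOpen_ball.mem_nhds (by simp))

lemma summable_qProd (x : ℂ) : Summable fun n : ℕ => ‖-(q ^ n * x)‖ := by
  simp only [norm_neg, norm_mul, norm_pow]
  exact (summable_geometric_of_lt_one (norm_nonneg _) hq).mul_right ‖x‖

lemma qProd_eq (x : ℂ) : qProd q x = (1 - x) * qProd q (q * x) := by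
  have h' : Multipliable fun n : ℕ => (1 + -(q ^ (n + 1) * x)) := by
    simpa [pow_succ, mul_assoc] using multipliable_one_add_of_summable (summable_qProd hq (q * x))
  rw [qProd, tprod_eq_zero_mul' (f := fun n : ℕ => (1 + -(q ^ n * x))) h', qProd]
  simp only [pow_zero, one_mul, pow_succ, mul_assoc]
  ring

lemma qProd_eq_zero_iff {x : ℂ} : qProd q x = 0 ↔ ∃ n : ℕ, q ^ n * x = 1 := by
  constructor
  · intro h
    by_contra! hn
    refine tprod_one_add_ne_zero_of_summable (f := fun n : ℕ => -(q ^ n * x)) (fun n => ?_)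
      (summable_qProd hq x) h
    rw [← sub_eq_add_neg, sub_ne_zero]
    exact (hn n).symm
  · rintro ⟨n, hn⟩
    induction n generalizing x with
    | zero => rw [qProd_eq hq]; simp_all
    | succ n ih => rw [qProd_eq hq, ih (by rw [← hn]; ring), mul_zero]

end qProd

section theta

open Complex Real

/-- A theta function with simple zeros exactly at the points of `ℤ ω₁ + ℤ ω₂`. -/
def thetaProd (ω₁ ω₂ z : ℂ) : ℂ :=
  qProd (cexp (2 * π * Complex.I * (ω₂ / ω₁))) (cexp (2 * π * Complex.I * (z / ω₁))) *
    qProd (cexp (2 * π * Complex.I * (ω₂ / ω₁)))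
      (cexp (2 * π * Complex.I * (ω₂ / ω₁)) * cexp (-(2 * π * Complex.I * (z / ω₁))))

variable {ω₁ ω₂ : ℂ}

lemma norm_exp_two_pi_I_lt_one {τ : ℂ} (h : 0 < τ.im) : ‖cexp (2 * π * Complex.I * τ)‖ < 1 := by
  rw [Complex.norm_exp, Real.exp_lt_one_iff]
  have : (2 * π * Complex.I * τ).re = -(2 * π * τ.im) := by simp
  rw [this]
  have := Real.pi_pos
  simp only [Left.neg_neg_iff]
  positivity

variable (h : 0 < (ω₂ / ω₁).im)

include h

lemma differentiable_thetaProd : Differentiable ℂ (thetaProd ω₁ ω₂) := by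
  have hd := differentiable_qProd (norm_exp_two_pi_I_lt_one h)
  unfold thetaProd
  exact (hd.comp (by fun_prop)).mul (hd.comp (by fun_prop))

omit h in
lemma ne_zero_of_im_div_pos (h : 0 < (ω₂ / ω₁).im) : ω₁ ≠ 0 := by
  rintro rfl; simp at h

/-- The first product vanishes on ℤω₁ - nω₂ and the second on ℤω₁ + (n + 1)ω₂, for n ≥ 0. Together
they account for all lattice points. -/
lemma thetaProd_eq_zero_iff {z : ℂ} :
    thetaProd ω₁ ω₂ z = 0 ↔ ∃ m n : ℤ, m * ω₁ + n * ω₂ = z := by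
  have h1 : ω₁ ≠ 0 := ne_zero_of_im_div_pos h
  have hpi : (2 * π * Complex.I : ℂ) ≠ 0 := Complex.two_pi_I_ne_zero
  have key : ∀ (y : ℂ), cexp (2 * π * Complex.I * (y / ω₁)) = 1 ↔ ∃ m : ℤ, y = m * ω₁ := by
    intro y
    rw [Complex.exp_eq_one_iff]
    refine exists_congr fun m => ?_
    rw [mul_comm (m : ℂ), mul_right_inj' hpi, div_eq_iff h1]
  rw [thetaProd, mul_eq_zero, qProd_eq_zero_iff (norm_exp_two_pi_I_lt_one h),
    qProd_eq_zero_iff (norm_exp_two_pi_I_lt_one h)]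
  have e1 : ∀ n : ℕ, cexp (2 * π * Complex.I * (ω₂ / ω₁)) ^ n * cexp (2 * π * Complex.I * (z / ω₁)) =
      cexp (2 * π * Complex.I * ((n * ω₂ + z) / ω₁)) := fun n => by
    rw [← Complex.exp_nat_mul, ← Complex.exp_add]; congr 1; ring
  have e2 : ∀ n : ℕ, cexp (2 * π * Complex.I * (ω₂ / ω₁)) ^ n *
      (cexp (2 * π * Complex.I * (ω₂ / ω₁)) * cexp (-(2 * π * Complex.I * (z / ω₁)))) =
      cexp (2 * π * Complex.I * (((n + 1) * ω₂ - z) / ω₁)) := fun n => by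
    rw [← Complex.exp_nat_mul, ← Complex.exp_add, ← Complex.exp_add]; congr 1; ring
  simp only [e1, e2, key]
  constructor
  · rintro (⟨n, m, hm⟩ | ⟨n, m, hm⟩)
    · exact ⟨m, -n, by push_cast; linear_combination -hm⟩
    · exact ⟨-m, n + 1, by push_cast; linear_combination hm⟩
  · rintro ⟨m, n, hmn⟩
    rcases le_or_gt n 0 with hn | hn
    · obtain ⟨k, hk⟩ := Int.eq_ofNat_of_zero_le (a := -n) (by omega)
      have hk' : (n : ℂ) = -(k : ℂ) := by
        have : n = -(k : ℤ) := by omega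
        rw [this]; push_cast; ring
      exact Or.inl ⟨k, m, by rw [← hmn, hk']; ring⟩
    · obtain ⟨k, hk⟩ := Int.eq_ofNat_of_zero_le (a := n - 1) (by omega)
      have hk' : (n : ℂ) = (k : ℂ) + 1 := by
        have : n = (k : ℤ) + 1 := by omega
        rw [this]; push_cast; ring
      exact Or.inr ⟨k, -m, by rw [← hmn, hk']; push_cast; ring⟩

omit h in
lemma thetaProd_add_first (h1 : ω₁ ≠ 0) (z : ℂ) :
    thetaProd ω₁ ω₂ (z + ω₁) = thetaProd ω₁ ω₂ z := by
  have e1 : cexp (2 * π * Complex.I * ((z + ω₁) / ω₁)) = cexp (2 * π * Complex.I * (z / ω₁)) := by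
    rw [add_div, div_self h1, mul_add, mul_one, Complex.exp_add, Complex.exp_two_pi_mul_I, mul_one]
  rw [thetaProd, thetaProd, Complex.exp_neg, e1, ← Complex.exp_neg]

/-- The shift replaces x = exp(2πi z/ω₁) by qx, so the first product loses its factor 1 - x and the
second gains 1 - x⁻¹. The quotient of these is -x⁻¹; the summand πi in the exponent encodes the
sign. -/
lemma thetaProd_add_second (z : ℂ) :
    thetaProd ω₁ ω₂ (z + ω₂) =
      cexp (-(2 * π * Complex.I / ω₁) * z + π * Complex.I) * thetaProd ω₁ ω₂ z := by
  have hq := norm_exp_two_pi_I_lt_one h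
  set q := cexp (2 * π * Complex.I * (ω₂ / ω₁))
  set x := cexp (2 * π * Complex.I * (z / ω₁)) with hx
  have hx0 : x ≠ 0 := Complex.exp_ne_zero _
  have e1 : cexp (2 * π * Complex.I * ((z + ω₂) / ω₁)) = q * x := by
    rw [← Complex.exp_add]; congr 1; ring
  have hq0 : q ≠ 0 := Complex.exp_ne_zero _
  have e2 : cexp (-(2 * π * Complex.I / ω₁) * z + π * Complex.I) = -x⁻¹ := by
    rw [Complex.exp_add, Complex.exp_pi_mul_I, hx, ← Complex.exp_neg, mul_neg_one]
    congr 2; ring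
  rw [thetaProd, thetaProd, Complex.exp_neg, Complex.exp_neg, e1, e2]
  change qProd q (q * x) * qProd q (q * (q * x)⁻¹) = -x⁻¹ * (qProd q x * qProd q (q * x⁻¹))
  have e3 : q * (q * x)⁻¹ = x⁻¹ := by field_simp
  rw [e3, qProd_eq hq x, qProd_eq hq x⁻¹]
  field_simp
  ring

/-- The zero at 0 comes from the single factor 1 - exp(2πi z/ω₁), which has a simple zero; the rest
takes the value `qProd q q ^ 2 ≠ 0` there. -/
lemma deriv_thetaProd_zero : deriv (thetaProd ω₁ ω₂) 0 ≠ 0 := by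
  have hq := norm_exp_two_pi_I_lt_one h
  have h1 : ω₁ ≠ 0 := ne_zero_of_im_div_pos h
  set q := cexp (2 * π * Complex.I * (ω₂ / ω₁)) with hqdef
  have hqn : ∀ n : ℕ, q ^ (n + 1) ≠ 1 := fun n hn => by
    have : ‖q‖ ^ (n + 1) = 1 := by rw [← norm_pow, hn, norm_one]
    exact (pow_lt_one₀ (norm_nonneg _) hq n.succ_ne_zero).ne this
  have hF : qProd q q ≠ 0 := by
    rw [Ne, qProd_eq_zero_iff hq]
    rintro ⟨n, hn⟩
    exact hqn n (by rw [pow_succ, hn])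
  have hd := differentiable_qProd hq
  have heq : thetaProd ω₁ ω₂ = fun z => (1 - cexp (2 * π * Complex.I * (z / ω₁))) *
      (qProd q (q * cexp (2 * π * Complex.I * (z / ω₁))) * qProd q (q * cexp (-(2 * π * Complex.I * (z / ω₁))))) := by
    ext z
    rw [thetaProd, qProd_eq hq (cexp (2 * π * Complex.I * (z / ω₁))), mul_assoc]
  have hg : DifferentiableAt ℂ (fun z : ℂ => qProd q (q * cexp (2 * π * Complex.I * (z / ω₁))) *
      qProd q (q * cexp (-(2 * π * Complex.I * (z / ω₁))))) 0 :=
    ((hd.comp (by fun_prop)).mul (hd.comp (by fun_prop)) : Differentiable ℂ _) 0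
  have hlin : HasDerivAt (fun z : ℂ => 2 * π * Complex.I * (z / ω₁)) (2 * π * Complex.I * (1 / ω₁)) 0 :=
    ((hasDerivAt_id (0 : ℂ)).div_const ω₁).const_mul _
  have hf := (hlin.cexp.const_sub 1).mul hg.hasDerivAt
  rw [heq]
  erw [hf.deriv]
  simp [hF, h1]

end theta

/-- A quasi-periodic entire function with simple zeros exactly at the lattice points. -/
theorem PeriodPair.exists_theta (L : PeriodPair) :
    ∃ Θ : ℂ → ℂ, Differentiable ℂ Θ ∧ (∀ z, Θ z = 0 ↔ z ∈ L.lattice) ∧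
      (∀ z ∈ L.lattice, deriv Θ z ≠ 0) ∧ (∀ z, Θ (z + L.ω₁) = Θ z) ∧
      ∃ a b : ℂ, (a * L.ω₁ = 2 * Real.pi * Complex.I ∨ a * L.ω₁ = -(2 * Real.pi * Complex.I)) ∧
        ∀ z, Θ (z + L.ω₂) = Complex.exp (a * z + b) * Θ z := by
  have hind := LinearIndependent.pair_iff.mp L.indep
  have h1 : L.ω₁ ≠ 0 := fun h => by simpa using hind 1 0 (by simp [h])
  have him : (L.ω₂ / L.ω₁).im ≠ 0 := by
    intro h
    have hr : L.ω₂ / L.ω₁ = ((L.ω₂ / L.ω₁).re : ℂ) := by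
      apply Complex.ext <;> simp [h]
    rw [div_eq_iff h1] at hr
    have := hind (-(L.ω₂ / L.ω₁).re) 1 (by
      rw [one_smul, Complex.real_smul]; push_cast; linear_combination hr)
    simp at this
  -- It is enough to know the derivative at 0: a translation by a lattice vector multiplies Θ by a
  -- nowhere vanishing exponential, so the zeros at all lattice points are simple as well.
  suffices H : ∃ Θ : ℂ → ℂ, Differentiable ℂ Θ ∧ (∀ z, Θ z = 0 ↔ z ∈ L.lattice) ∧
      deriv Θ 0 ≠ 0 ∧ (∀ z, Θ (z + L.ω₁) = Θ z) ∧
      ∃ a b : ℂ, (a * L.ω₁ = 2 * Real.pi * Complex.I ∨ a * L.ω₁ = -(2 * Real.pi * Complex.I)) ∧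
        ∀ z, Θ (z + L.ω₂) = Complex.exp (a * z + b) * Θ z by
    obtain ⟨Θ, hd, hz, h0, hp1, a, b, hab, hp2⟩ := H
    refine ⟨Θ, hd, hz, fun w hw => ?_, hp1, a, b, hab, hp2⟩
    have main : ∀ w ∈ L.lattice, ∃ c d : ℂ, ∀ z, Θ (z + w) = Complex.exp (c * z + d) * Θ z := by
      intro w hw
      induction hw using Submodule.span_induction with
      | mem x hx =>
        rcases hx with rfl | rfl
        · exact ⟨0, 0, fun z => by simp [hp1]⟩
        · exact ⟨a, b, hp2⟩
      | zero => exact ⟨0, 0, fun z => by simp⟩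
      | add x y _ _ hx hy =>
        obtain ⟨c, d, hx⟩ := hx
        obtain ⟨c', d', hy⟩ := hy
        refine ⟨c + c', c' * x + d + d', fun z => ?_⟩
        rw [← add_assoc, hy, hx, ← mul_assoc, ← Complex.exp_add]
        congr 2; ring
      | smul n x _ hx =>
        obtain ⟨c, d, hx⟩ := hx
        have hx' : ∀ z, Θ (z + -x) = Complex.exp (-c * z + (c * x - d)) * Θ z := fun z => by
          have := hx (z + -x)
          rw [neg_add_cancel_right] at this
          rw [this, ← mul_assoc, ← Complex.exp_add]
          ring_nf
          simp
        induction n using Int.induction_on with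
        | zero => exact ⟨0, 0, fun z => by simp⟩
        | succ n ih =>
          obtain ⟨c', d', ih⟩ := ih
          refine ⟨c + c', c * ((n : ℤ) • x) + d + d', fun z => ?_⟩
          rw [add_smul, one_smul, ← add_assoc, hx, ih, ← mul_assoc, ← Complex.exp_add]
          congr 2; ring
        | pred n ih =>
          obtain ⟨c', d', ih⟩ := ih
          refine ⟨-c + c', -c * ((-(n : ℤ)) • x) + (c * x - d) + d', fun z => ?_⟩
          rw [sub_smul, one_smul, sub_eq_add_neg, ← add_assoc, hx', ih, ← mul_assoc,
            ← Complex.exp_add]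
          congr 2; ring
    obtain ⟨c, d, hw'⟩ := main w hw
    have hΘ0 : Θ 0 = 0 := (hz 0).mpr (zero_mem _)
    have e1 : HasDerivAt (fun z => Θ (z + w)) (deriv Θ w) 0 := by
      have := (hd (0 + w)).hasDerivAt.comp_add_const (x := 0)
      simpa using this
    have e2 : HasDerivAt (fun z => Complex.exp (c * z + d) * Θ z)
        (Complex.exp (c * 0 + d) * (c * 1) * Θ 0 + Complex.exp (c * 0 + d) * deriv Θ 0) 0 :=
      ((((hasDerivAt_id (0 : ℂ)).const_mul c).add_const d).cexp).mul (hd 0).hasDerivAt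
    rw [show (fun z => Θ (z + w)) = _ from funext hw'] at e1
    rw [e1.unique e2, hΘ0]
    simp [h0]
  -- The product converges only for Im(ω₂/ω₁) > 0; otherwise -ω₂ takes the place of ω₂. This is the
  -- source of the two signs of a ω₁.
  rcases lt_or_gt_of_ne him with hneg | hpos
  · have h' : 0 < (-L.ω₂ / L.ω₁).im := by rw [neg_div, Complex.neg_im]; linarith
    refine ⟨thetaProd L.ω₁ (-L.ω₂), differentiable_thetaProd h', fun z => ?_,
      deriv_thetaProd_zero h', thetaProd_add_first h1, 2 * Real.pi * Complex.I / L.ω₁,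
      2 * Real.pi * Complex.I / L.ω₁ * L.ω₂ - Real.pi * Complex.I, Or.inl (by field_simp),
      fun z => ?_⟩
    · rw [thetaProd_eq_zero_iff h', PeriodPair.mem_lattice]
      constructor
      · rintro ⟨m, n, h⟩; exact ⟨m, -n, by rw [← h]; push_cast; ring⟩
      · rintro ⟨m, n, h⟩; exact ⟨m, -n, by rw [← h]; push_cast; ring⟩
    · have := thetaProd_add_second h' (z + L.ω₂)
      rw [add_neg_cancel_right] at this
      rw [this, ← mul_assoc, ← Complex.exp_add]
      ring_nf
      simp
  · refine ⟨thetaProd L.ω₁ L.ω₂, differentiable_thetaProd hpos, fun z => ?_,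
      deriv_thetaProd_zero hpos, thetaProd_add_first h1, -(2 * Real.pi * Complex.I / L.ω₁),
      Real.pi * Complex.I, Or.inr (by field_simp), thetaProd_add_second hpos⟩
    rw [thetaProd_eq_zero_iff hpos, PeriodPair.mem_lattice]

end

/-! ### The Weierstrass zeta function, the singular set and the periodicity of the potential. -/

noncomputable section

namespace PeriodPair

variable (L : PeriodPair)

/-- The three fractions combine to s² / ((s - l) l²), whose order l⁻³ is summable over a planar
lattice. -/
lemma weierstrassZeta_bound {r : ℝ} (hr : 0 < r) {s : ℂ} (hs : ‖s‖ < r) {l : ℂ}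
    (h : 2 * r ≤ ‖l‖) :
    ‖1 / (s - l) + 1 / l + s / l ^ 2‖ ≤ 2 * r ^ 2 * ‖l‖ ^ (-3 : ℝ) := by
  have h0 : 0 < ‖l‖ := by linarith
  have hl : l ≠ 0 := norm_pos_iff.mp h0
  have hsl : ‖l‖ / 2 ≤ ‖s - l‖ := by
    rw [norm_sub_rev]; exact .trans (by linarith) (norm_sub_norm_le l s)
  have hsl' : s - l ≠ 0 := norm_pos_iff.mp (by linarith)
  have e : 1 / (s - l) + 1 / l + s / l ^ 2 = s ^ 2 / ((s - l) * l ^ 2) := by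
    field_simp; ring
  rw [e, norm_div, norm_mul, norm_pow, norm_pow]
  calc ‖s‖ ^ 2 / (‖s - l‖ * ‖l‖ ^ 2) ≤ r ^ 2 / (‖l‖ / 2 * ‖l‖ ^ 2) := by gcongr
    _ = 2 * r ^ 2 / ‖l‖ ^ 3 := by field_simp
    _ = _ := by norm_cast

lemma hasSumLocallyUniformly_weierstrassZeta :
    HasSumLocallyUniformly
      (fun (l : L.lattice) (z : ℂ) ↦ 1 / (z - l) + 1 / (l : ℂ) + z / (l : ℂ) ^ 2)
      L.weierstrassZeta := by
  refine L.hasSumLocallyUniformly_aux (u := (2 * · ^ 2 * ‖·‖ ^ (-3 : ℝ))) _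
    (fun _ _ ↦ (ZLattice.summable_norm_rpow _ _ (by simp; norm_num)).mul_left _) fun r hr ↦
    Filter.eventually_atTop.mpr ⟨2 * r, ?_⟩
  rintro _ h s hs l rfl
  exact weierstrassZeta_bound hr hs h

lemma hasDerivAt_weierstrassZeta_summand {z l : ℂ} (hz : z ≠ l) :
    HasDerivAt (fun z : ℂ => 1 / (z - l) + 1 / l + z / l ^ 2)
      (-(1 / (z - l) ^ 2 - 1 / l ^ 2)) z := by
  have h0 : z - l ≠ 0 := sub_ne_zero.mpr hz
  have h1 : HasDerivAt (fun z : ℂ => z - l) 1 z := (hasDerivAt_id z).sub_const l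
  have h2 := h1.fun_inv h0
  simp only [one_div]
  exact ((h2.add_const l⁻¹).add ((hasDerivAt_id z).div_const (l ^ 2))).congr_deriv (by
    field_simp; ring)

lemma ne_coe_of_mem_compl_lattice {z : ℂ} (hz : z ∈ (L.lattice : Set ℂ)ᶜ) (l : L.lattice) :
    z ≠ l := fun h => hz (h ▸ l.2)

lemma isOpen_compl_lattice : IsOpen (L.lattice : Set ℂ)ᶜ := L.isClosed_lattice.isOpen_compl

lemma differentiableOn_weierstrassZeta :
    DifferentiableOn ℂ L.weierstrassZeta (L.lattice : Set ℂ)ᶜ :=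
  L.hasSumLocallyUniformly_weierstrassZeta.tendstoLocallyUniformlyOn.differentiableOn
    (.of_forall fun _ ↦ .fun_sum fun i _ _ hz ↦ (hasDerivAt_weierstrassZeta_summand
      (L.ne_coe_of_mem_compl_lattice hz i)).differentiableAt.differentiableWithinAt)
    L.isOpen_compl_lattice

/-- Locally uniform convergence permits termwise differentiation, which yields minus the series of
℘. -/
lemma hasDerivAt_weierstrassZeta {z : ℂ} (hz : z ∉ L.lattice) :
    HasDerivAt L.weierstrassZeta (-L.weierstrassP z) z := by
  have h := (L.hasSumLocallyUniformly_weierstrassZeta.tendstoLocallyUniformlyOn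
    (s := (L.lattice : Set ℂ)ᶜ)).deriv
    (.of_forall fun _ ↦ .fun_sum fun i _ _ hz ↦ (hasDerivAt_weierstrassZeta_summand
      (L.ne_coe_of_mem_compl_lattice hz i)).differentiableAt.differentiableWithinAt)
    L.isOpen_compl_lattice
  have h1 := h.tendsto_at (a := z) hz
  have h2 := (L.hasSum_weierstrassP z).neg
  have e : deriv L.weierstrassZeta z = -L.weierstrassP z := by
    refine tendsto_nhds_unique h1 (h2.congr fun s => ?_)
    simp only [Function.comp_apply]
    exact (HasDerivAt.fun_sum fun (i : L.lattice) _ => hasDerivAt_weierstrassZeta_summand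
      (L.ne_coe_of_mem_compl_lattice hz i)).deriv.symm
  rw [← e]
  exact (L.differentiableOn_weierstrassZeta.differentiableAt
    (L.isOpen_compl_lattice.mem_nhds hz)).hasDerivAt

lemma countable_lattice : (L.lattice : Set ℂ).Countable :=
  countable_of_Lindelof_of_discrete (X := L.lattice)

/-- The Weierstrass zeta function is quasi-periodic. -/
lemma exists_weierstrassZeta_add {l : ℂ} (hl : l ∈ L.lattice) :
    ∃ c, ∀ z ∉ L.lattice, L.weierstrassZeta (z + l) = L.weierstrassZeta z + c := by
  have hmem : ∀ z ∉ L.lattice, z + l ∉ L.lattice := fun z hz h =>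
    hz (by simpa using sub_mem h hl)
  have hd : ∀ z ∉ L.lattice,
      HasDerivAt (fun z => L.weierstrassZeta (z + l) - L.weierstrassZeta z) 0 z := by
    intro z hz
    have h1 := (L.hasDerivAt_weierstrassZeta (hmem z hz)).comp_add_const z l
    have h2 := L.weierstrassP_add_coe z ⟨l, hl⟩
    simp only at h2
    exact (h1.sub (L.hasDerivAt_weierstrassZeta hz)).congr_deriv (by rw [h2]; ring)
  -- The difference has derivative zero because ℘ is periodic, and it is constant because the
  -- complement of a countable set in the plane is connected.
  obtain ⟨c, hc⟩ := L.isOpen_compl_lattice.exists_is_const_of_deriv_eq_zero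
    (L.countable_lattice.isConnected_compl_of_one_lt_rank (by simp)).isPreconnected
    (fun z hz => (hd z hz).differentiableAt.differentiableWithinAt) fun z hz => (hd z hz).deriv
  exact ⟨c, fun z hz => by rw [← hc z hz]; ring⟩

end PeriodPair

namespace GeneralizedLame

variable (D : GeneralizedLame)

lemma proj_eq_iff {z w : ℂ} : D.proj z = D.proj w ↔ z - w ∈ D.L.lattice := by
  rw [proj, proj, eq_comm, QuotientAddGroup.eq, neg_add_eq_sub]
  rfl

lemma proj_add {z l : ℂ} (hl : l ∈ D.L.lattice) : D.proj (z + l) = D.proj z := by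
  rw [proj_eq_iff]; simpa

/-- The points of the plane which lie over singular points. -/
def singularSet : Set ℂ := {z | ∃ i, D.proj z = D.proj (D.p i)}

variable {D}

lemma mem_singularSet {z : ℂ} : z ∈ D.singularSet ↔ ∃ i, z - D.p i ∈ D.L.lattice := by
  simp only [singularSet, proj_eq_iff, Set.mem_ofPred_eq]

lemma add_mem_singularSet_iff {z l : ℂ} (hl : l ∈ D.L.lattice) :
    z + l ∈ D.singularSet ↔ z ∈ D.singularSet := by
  simp only [singularSet, D.proj_add hl, Set.mem_ofPred_eq]

lemma countable_singularSet : D.singularSet.Countable := by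
  have : D.singularSet = ⋃ i, (fun z => z - D.p i) ⁻¹' (D.L.lattice : Set ℂ) := by
    ext z; simp [mem_singularSet]
  rw [this]
  exact Set.countable_iUnion fun i =>
    D.L.countable_lattice.preimage sub_left_injective

lemma isClosed_singularSet_sdiff (z₀ : ℂ) : IsClosed (D.singularSet \ {z₀}) := by
  have : D.singularSet \ {z₀} =
      ⋃ i, (fun z => z - D.p i) ⁻¹' ((D.L.lattice : Set ℂ) \ {z₀ - D.p i}) := by
    ext z; simp [mem_singularSet]
  rw [this]
  exact isClosed_iUnion_of_finite fun i =>
    (D.L.isClosed_of_subset_lattice Set.sdiff_subset).preimage (by fun_prop)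

lemma isClosed_singularSet : IsClosed D.singularSet := by
  have : D.singularSet =
      ⋃ i, (fun z => z - D.p i) ⁻¹' (D.L.lattice : Set ℂ) := by
    ext z; simp [mem_singularSet]
  rw [this]
  exact isClosed_iUnion_of_finite fun i => D.L.isClosed_lattice.preimage (by fun_prop)

lemma exists_ball_singularSet (z₀ : ℂ) :
    ∃ r > 0, ∀ z ∈ Metric.ball z₀ r, z ∈ D.singularSet → z = z₀ := by
  have h : (D.singularSet \ {z₀})ᶜ ∈ 𝓝 z₀ :=
    (isClosed_singularSet_sdiff z₀).isOpen_compl.mem_nhds (by simp)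
  obtain ⟨r, hr, h⟩ := Metric.mem_nhds_iff.mp h
  exact ⟨r, hr, fun z hz hs => by_contra fun hne => h hz ⟨hs, hne⟩⟩

lemma differentiableOn_potential : DifferentiableOn ℂ D.potential D.singularSetᶜ := by
  intro z hz
  have hz' : ∀ i, z - D.p i ∉ D.L.lattice := fun i h => hz (mem_singularSet.mpr ⟨i, h⟩)
  have h1 : ∀ i, DifferentiableAt ℂ (fun z => D.L.weierstrassP (z - D.p i)) z := fun i =>
    (D.L.differentiableOn_weierstrassP.differentiableAt
      (D.L.isOpen_compl_lattice.mem_nhds (hz' i))).comp z (f := fun z => z - D.p i) (by fun_prop)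
  have h2 : ∀ i, DifferentiableAt ℂ (fun z => D.L.weierstrassZeta (z - D.p i)) z := fun i =>
    (D.L.hasDerivAt_weierstrassZeta (hz' i)).differentiableAt.comp z
      (f := fun z => z - D.p i) (by fun_prop)
  refine DifferentiableAt.differentiableWithinAt ?_
  unfold potential
  exact ((DifferentiableAt.fun_sum fun i _ => (h1 i).const_mul _).add
    (DifferentiableAt.fun_sum fun i _ => (h2 i).const_mul _)).add_const _

lemma analyticAt_potential {z : ℂ} (hz : z ∉ D.singularSet) : AnalyticAt ℂ D.potential z :=
  differentiableOn_potential.analyticAt (isClosed_singularSet.isOpen_compl.mem_nhds hz)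

/-- Every ζ(z - pᵢ) changes by the same constant c, so the potential changes by c ∑ Aᵢ = 0. -/
lemma potential_add {z l : ℂ} (hl : l ∈ D.L.lattice) (hz : z ∉ D.singularSet) :
    D.potential (z + l) = D.potential z := by
  have hz' : ∀ i, z - D.p i ∉ D.L.lattice := fun i h => hz (mem_singularSet.mpr ⟨i, h⟩)
  obtain ⟨c, hc⟩ := D.L.exists_weierstrassZeta_add hl
  have h1 : ∀ i, D.L.weierstrassP (z + l - D.p i) = D.L.weierstrassP (z - D.p i) := fun i => by
    have := D.L.weierstrassP_add_coe (z - D.p i) ⟨l, hl⟩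
    rw [← this]; congr 1; ring
  have h2 : ∀ i, D.L.weierstrassZeta (z + l - D.p i) = D.L.weierstrassZeta (z - D.p i) + c :=
    fun i => by
      rw [← hc _ (hz' i)]; congr 1; ring
  simp only [potential, h1, h2, mul_add, Finset.sum_add_distrib, ← Finset.sum_mul, D.sum_A]
  ring

end GeneralizedLame

end

/-! ### Branches of square roots, the divisor function Ψ and the equation for h = w √Ψ. -/

noncomputable section

/-- Two square roots of the same function which agree at a point agree near that point. -/
lemma eventuallyEq_of_sq_eq {X : Type*} [TopologicalSpace X] {f g : X → ℂ} {x : X}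
    (hf : ContinuousAt f x) (hg : ContinuousAt g x)
    (h : ∀ᶠ y in 𝓝 x, f y ^ 2 = g y ^ 2) (hx : f x = g x) (h0 : f x ≠ 0) : f =ᶠ[𝓝 x] g := by
  have h1 : ∀ᶠ y in 𝓝 x, f y + g y ≠ 0 := by
    refine (hf.add hg).eventually_ne ?_
    rw [Pi.add_apply, ← hx, ← two_mul]
    exact mul_ne_zero two_ne_zero h0
  filter_upwards [h, h1] with y hy hy1
  have : (f y - g y) * (f y + g y) = 0 := by linear_combination hy
  exact sub_eq_zero.mp ((mul_eq_zero.mp this).resolve_right hy1)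

/-- The branch of the square root of `F` near `z₀` with value `s` at `z₀`, where `s ^ 2 = F z₀`. -/
def sqrtBranch (F : ℂ → ℂ) (z₀ s z : ℂ) : ℂ := s * (F z / F z₀) ^ (1 / 2 : ℂ)

lemma sqrtBranch_self {F : ℂ → ℂ} {z₀ s : ℂ} (h0 : F z₀ ≠ 0) : sqrtBranch F z₀ s z₀ = s := by
  simp [sqrtBranch, h0]

lemma sqrtBranch_sq {F : ℂ → ℂ} {z₀ s : ℂ} (h0 : F z₀ ≠ 0) (hs : s ^ 2 = F z₀) (z : ℂ) :
    sqrtBranch F z₀ s z ^ 2 = F z := by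
  have : ((F z / F z₀) ^ (1 / 2 : ℂ)) ^ 2 = F z / F z₀ := by
    rw [← Complex.cpow_nat_mul]; norm_num
  rw [sqrtBranch, mul_pow, this, hs]
  field_simp

/-- Near z₀ the quotient F / F z₀ is close to 1 and stays in the slit plane, where the principal
power is holomorphic. The radius does not depend on the chosen root `s`. -/
lemma exists_sqrtBranch_differentiableOn {F : ℂ → ℂ} (hF : Differentiable ℂ F) {z₀ : ℂ}
    (h0 : F z₀ ≠ 0) :
    ∃ r > 0, ∀ s, DifferentiableOn ℂ (sqrtBranch F z₀ s) (Metric.ball z₀ r) := by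
  have hc : ContinuousAt (fun z => F z / F z₀) z₀ := (hF z₀).continuousAt.div_const _
  have : ∀ᶠ z in 𝓝 z₀, F z / F z₀ ∈ Complex.slitPlane := by
    refine hc.eventually (Complex.isOpen_slitPlane.mem_nhds ?_)
    change F z₀ / F z₀ ∈ _
    rw [div_self h0]; exact Complex.one_mem_slitPlane
  obtain ⟨r, hr, h⟩ := Metric.eventually_nhds_iff_ball.mp this
  refine ⟨r, hr, fun s z hz => DifferentiableAt.differentiableWithinAt ?_⟩
  exact (((hF z).div_const _).cpow_const (h z hz)).const_mul s

/-- In polar coordinates the punctured disc is the continuous image of (0, r) × ℝ. -/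
lemma isPreconnected_ball_sdiff_singleton (z₀ : ℂ) (r : ℝ) :
    IsPreconnected (Metric.ball z₀ r \ {z₀}) := by
  have h : IsPreconnected ((fun x : ℝ × ℝ => z₀ + x.1 * Complex.exp (x.2 * Complex.I)) ''
      (Set.Ioo 0 r ×ˢ Set.univ)) :=
    (isPreconnected_Ioo.prod isPreconnected_univ).image _ (by fun_prop)
  convert h using 1
  ext z
  simp only [Set.mem_sdiff, Metric.mem_ball, Set.mem_singleton_iff, Set.mem_image, Set.mem_prod,
    Set.mem_Ioo, Set.mem_univ, and_true, Prod.exists]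
  constructor
  · rintro ⟨h1, h2⟩
    refine ⟨‖z - z₀‖, (z - z₀).arg, ⟨norm_pos_iff.mpr (sub_ne_zero.mpr h2), ?_⟩, ?_⟩
    · rwa [← dist_eq_norm]
    · rw [Complex.norm_mul_exp_arg_mul_I]; ring
  · rintro ⟨t, θ, ⟨h1, h2⟩, rfl⟩
    have : ‖(t : ℂ) * Complex.exp (θ * Complex.I)‖ = t := by
      rw [norm_mul, Complex.norm_exp_ofReal_mul_I, mul_one, Complex.norm_real, Real.norm_eq_abs,
        abs_of_pos h1]
    refine ⟨by rw [dist_eq_norm, add_sub_cancel_left, this]; exact h2, fun h => ?_⟩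
    rw [add_eq_left] at h
    rw [h, norm_zero] at this
    exact h1.ne this

namespace GeneralizedLame

variable {D : GeneralizedLame}

/-- `Ψ` is a quasi-periodic entire function whose zeros are the singular points, with the strengths
as multiplicities. -/
structure IsDivisorFunction (D : GeneralizedLame) (Ψ : ℂ → ℂ) : Prop where
  differentiable : Differentiable ℂ Ψ
  ne_zero : ∀ z ∉ D.singularSet, Ψ z ≠ 0
  factor : ∀ i z₀, z₀ - D.p i ∈ D.L.lattice → ∃ G : ℂ → ℂ, Differentiable ℂ G ∧
    (∀ z, Ψ z = (z - z₀) ^ D.ell i * G z) ∧ ∀ z, G z = 0 → z ∈ D.singularSet ∧ z ≠ z₀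
  add_first : ∀ z, Ψ (z + D.L.ω₁) = Ψ z
  add_second : ∃ a b : ℂ, (a * D.L.ω₁ = (∑ i, D.ell i : ℕ) * (2 * Real.pi * Complex.I) ∨
    a * D.L.ω₁ = -((∑ i, D.ell i : ℕ) * (2 * Real.pi * Complex.I))) ∧
    ∀ z, Ψ (z + D.L.ω₂) = Complex.exp (a * z + b) * Ψ z

/-- Ψ is the product of the Θ(z - pᵢ) ^ ℓᵢ. The exponents of the multipliers add up, so the slope a
of Θ becomes a ∑ ℓᵢ. -/
theorem exists_isDivisorFunction (D : GeneralizedLame) : ∃ Ψ, IsDivisorFunction D Ψ := by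
  obtain ⟨Θ, hd, hz, hder, hp1, a, b, hab, hp2⟩ := D.L.exists_theta
  refine ⟨fun z => ∏ i, Θ (z - D.p i) ^ D.ell i, ?_, ?_, ?_, ?_, ?_⟩
  · have : ∀ i, Differentiable ℂ fun z => Θ (z - D.p i) := fun i => hd.comp (by fun_prop)
    exact Differentiable.fun_finsetProd fun i _ => (this i).fun_pow _
  · intro z hzs
    refine Finset.prod_ne_zero_iff.mpr fun i _ => pow_ne_zero _ fun h => hzs ?_
    exact mem_singularSet.mpr ⟨i, (hz _).mp h⟩
  · intro i z₀ hz₀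
    set l := z₀ - D.p i with hl
    have hΘl : Θ l = 0 := (hz l).mpr hz₀
    have hds : Differentiable ℂ (dslope Θ l) := by
      rw [← differentiableOn_univ, Complex.differentiableOn_dslope Filter.univ_mem]
      exact hd.differentiableOn
    have hfac : ∀ z, Θ (z - D.p i) = (z - z₀) * dslope Θ l (z - D.p i) := by
      intro z
      have := sub_smul_dslope Θ l (z - D.p i)
      rw [hΘl, sub_zero, smul_eq_mul] at this
      rw [← this, hl]; ring
    -- `dslope Θ l` is Θ with its zero at l divided out; its value at l is Θ'(l) ≠ 0. The remaining
    -- factors do not vanish at z₀ because the pᵢ are distinct modulo Λ.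
    refine ⟨fun z => dslope Θ l (z - D.p i) ^ D.ell i *
      ∏ j ∈ Finset.univ.erase i, Θ (z - D.p j) ^ D.ell j, ?_, ?_, ?_⟩
    · have : ∀ i, Differentiable ℂ fun z => Θ (z - D.p i) := fun i => hd.comp (by fun_prop)
      have h2 : Differentiable ℂ fun z => dslope Θ l (z - D.p i) := hds.comp (by fun_prop)
      exact (h2.fun_pow _).mul (Differentiable.fun_finsetProd fun i _ => (this i).fun_pow _)
    · intro z
      rw [← Finset.mul_prod_erase _ _ (Finset.mem_univ i), hfac, mul_pow]
      ring
    · intro z h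
      rcases mul_eq_zero.mp h with h | h
      · have h' := eq_zero_of_pow_eq_zero h
        refine ⟨mem_singularSet.mpr ⟨i, (hz _).mp (by rw [hfac, h', mul_zero])⟩, ?_⟩
        rintro rfl
        rw [← hl, dslope_same] at h'
        exact hder l hz₀ h'
      · obtain ⟨j, hj, h'⟩ := Finset.prod_eq_zero_iff.mp h
        have h'' := (hz _).mp (eq_zero_of_pow_eq_zero h')
        refine ⟨mem_singularSet.mpr ⟨j, h''⟩, ?_⟩
        rintro rfl
        refine D.p_distinct i j (Finset.ne_of_mem_erase hj).symm ?_
        have := sub_mem h'' hz₀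
        rwa [hl, sub_sub_sub_cancel_left] at this
  · intro z
    refine Finset.prod_congr rfl fun i _ => ?_
    rw [add_sub_right_comm, hp1]
  · refine ⟨(∑ i, D.ell i : ℕ) * a, ∑ i, D.ell i * (b - a * D.p i), ?_, fun z => ?_⟩
    · rcases hab with h | h
      · exact Or.inl (by rw [mul_assoc, h])
      · exact Or.inr (by rw [mul_assoc, h, mul_neg])
    · have : ∀ i, Θ (z + D.L.ω₂ - D.p i) ^ D.ell i =
          Complex.exp (D.ell i * (a * z + (b - a * D.p i))) * Θ (z - D.p i) ^ D.ell i := by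
        intro i
        rw [add_sub_right_comm, hp2, mul_pow, Complex.exp_nat_mul]
        congr 3; ring
      simp only [this, Finset.prod_mul_distrib, ← Complex.exp_sum]
      congr 2
      push_cast
      rw [Finset.sum_mul, Finset.sum_mul, ← Finset.sum_add_distrib]
      exact Finset.sum_congr rfl fun i _ => by ring

/-- The function `h` is holomorphic at `z` and, if `z` is not singular, satisfies the equation
which says that `h / √Ψ` is a solution of the generalized Lamé equation. -/
def GoodAt (D : GeneralizedLame) (Ψ h : ℂ → ℂ) (z : ℂ) : Prop :=
  AnalyticAt ℂ h z ∧ (z ∉ D.singularSet → deriv (deriv h) z = logDeriv Ψ z * deriv h z +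
    (D.potential z + deriv (logDeriv Ψ) z / 2 - logDeriv Ψ z ^ 2 / 4) * h z)

lemma GoodAt.congr {Ψ h h' : ℂ → ℂ} {z : ℂ} (hg : GoodAt D Ψ h z) (he : h' =ᶠ[𝓝 z] h) :
    GoodAt D Ψ h' z := by
  refine ⟨hg.1.congr he.symm, fun hz => ?_⟩
  rw [he.deriv.deriv_eq, he.deriv_eq, he.eq_of_nhds, hg.2 hz]

namespace IsDivisorFunction

variable {Ψ : ℂ → ℂ} (hΨ : IsDivisorFunction D Ψ)
include hΨ

lemma analyticAt_logDeriv {z : ℂ} (hz : z ∉ D.singularSet) : AnalyticAt ℂ (logDeriv Ψ) z :=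
  ((hΨ.differentiable.analyticAt z).deriv).div (hΨ.differentiable.analyticAt z) (hΨ.ne_zero z hz)

lemma hasDerivAt_sqrt {τ : ℂ → ℂ} {z : ℂ} (hz : z ∉ D.singularSet) (hτ : DifferentiableAt ℂ τ z)
    (h : ∀ᶠ w in 𝓝 z, τ w ^ 2 = Ψ w) : HasDerivAt τ (logDeriv Ψ z / 2 * τ z) z := by
  have h0 : Ψ z ≠ 0 := hΨ.ne_zero z hz
  have hz2 : τ z ^ 2 = Ψ z := h.self_of_nhds
  have hs0 : τ z ≠ 0 := fun e => h0 (by rw [← hz2, e]; ring)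
  have h1 : HasDerivAt (fun w => τ w ^ 2) (2 * τ z * deriv τ z) z := by
    simpa using hτ.hasDerivAt.fun_pow 2
  have h2 : deriv Ψ z = 2 * τ z * deriv τ z :=
    (hΨ.differentiable z).hasDerivAt.unique (h1.congr_of_eventuallyEq
      (by filter_upwards [h] with w hw using hw.symm))
  have h3 : logDeriv Ψ z / 2 * τ z = deriv τ z := by
    rw [logDeriv_apply, h2, ← hz2]; field_simp
  rw [h3]; exact hτ.hasDerivAt

section Conversion

variable {τ : ℂ → ℂ} {U : Set ℂ} (hU : IsOpen U) (hUs : ∀ z ∈ U, z ∉ D.singularSet)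
  (hτ : DifferentiableOn ℂ τ U) (hτ2 : ∀ z ∈ U, τ z ^ 2 = Ψ z)
include hU hUs hτ hτ2

lemma hasDerivAt_sqrt_of_mem {z : ℂ} (hz : z ∈ U) :
    HasDerivAt τ (logDeriv Ψ z / 2 * τ z) z :=
  hΨ.hasDerivAt_sqrt (hUs z hz) (hτ.differentiableAt (hU.mem_nhds hz))
    (by filter_upwards [hU.mem_nhds hz] with w hw using hτ2 w hw)

/-- Put φ = Ψ'/Ψ, so τ' = φτ/2. Then h = uτ has h' = u'τ + φh/2, and eliminating u'τ from h'' leaves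
only φ, φ' and the potential. The choice of the root τ disappears from the equation. -/
lemma goodAt_mul {u : ℂ → ℂ} (hu : SolvesLinear D.potential u U) {z : ℂ} (hz : z ∈ U) :
    GoodAt D Ψ (fun z => u z * τ z) z := by
  refine ⟨(hu.1.mul hτ).analyticAt (hU.mem_nhds hz), fun _ => ?_⟩
  have hs := fun w (hw : w ∈ U) => hΨ.hasDerivAt_sqrt_of_mem hU hUs hτ hτ2 hw
  have h1 : ∀ w ∈ U, deriv (fun z => u z * τ z) w =
      deriv u w * τ w + u w * (logDeriv Ψ w / 2 * τ w) := fun w hw =>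
    ((hu.hasDerivAt hU hw).mul (hs w hw)).deriv
  have h1' : deriv (fun z => u z * τ z) =ᶠ[𝓝 z]
      fun w => deriv u w * τ w + u w * (logDeriv Ψ w / 2 * τ w) := by
    filter_upwards [hU.mem_nhds hz] with w hw using h1 w hw
  have hφ := (hΨ.analyticAt_logDeriv (hUs z hz)).differentiableAt.hasDerivAt
  have h2 := (((hu.hasDerivAt_deriv hU hz).mul (hs z hz)).add
    ((hu.hasDerivAt hU hz).mul ((hφ.div_const 2).mul (hs z hz)))).deriv
  rw [h1'.deriv_eq, h1 z hz]
  erw [h2]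
  simp only [Pi.mul_apply]
  ring

lemma solvesLinear_div {h : ℂ → ℂ} (hh : ∀ z ∈ U, GoodAt D Ψ h z) :
    SolvesLinear D.potential (fun z => h z / τ z) U := by
  have hs := fun w (hw : w ∈ U) => hΨ.hasDerivAt_sqrt_of_mem hU hUs hτ hτ2 hw
  have hs0 : ∀ w ∈ U, τ w ≠ 0 := fun w hw e =>
    hΨ.ne_zero w (hUs w hw) (by rw [← hτ2 w hw, e]; ring)
  refine SolvesLinear.of_hasDerivAt (u' := fun z => (deriv h z - logDeriv Ψ z / 2 * h z) / τ z) hU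
    (fun z hz => ?_) fun z hz => ?_
  · have h0 := hs0 z hz
    refine ((hh z hz).1.differentiableAt.hasDerivAt.div (hs z hz) h0).congr_deriv ?_
    field_simp
  · have h0 := hs0 z hz
    have hφ := (hΨ.analyticAt_logDeriv (hUs z hz)).differentiableAt.hasDerivAt
    have hh1 := (hh z hz).1.differentiableAt.hasDerivAt
    have hh2 := (hh z hz).1.deriv.differentiableAt.hasDerivAt
    refine ((hh2.sub ((hφ.div_const 2).mul hh1)).div (hs z hz) h0).congr_deriv ?_
    rw [(hh z hz).2 (hUs z hz)]
    simp only [Pi.sub_apply, Pi.mul_apply]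
    field_simp
    ring

end Conversion

lemma exists_sqrt {z₀ : ℂ} (hz₀ : z₀ ∉ D.singularSet) :
    ∃ r > 0, (∀ z ∈ Metric.ball z₀ r, z ∉ D.singularSet) ∧ ∀ s, s ^ 2 = Ψ z₀ →
      DifferentiableOn ℂ (sqrtBranch Ψ z₀ s) (Metric.ball z₀ r) ∧
      (∀ z, sqrtBranch Ψ z₀ s z ^ 2 = Ψ z) ∧ sqrtBranch Ψ z₀ s z₀ = s := by
  have h0 := hΨ.ne_zero z₀ hz₀
  obtain ⟨r₁, hr₁, h₁⟩ := exists_sqrtBranch_differentiableOn hΨ.differentiable h0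
  obtain ⟨r₂, hr₂, h₂⟩ := Metric.mem_nhds_iff.mp (isClosed_singularSet.isOpen_compl.mem_nhds hz₀)
  refine ⟨min r₁ r₂, lt_min hr₁ hr₂,
    fun z hz => h₂ (Metric.ball_subset_ball (min_le_right _ _) hz), fun s hs =>
    ⟨(h₁ s).mono (Metric.ball_subset_ball (min_le_left _ _)), sqrtBranch_sq h0 hs,
      sqrtBranch_self h0⟩⟩

/-- Near a regular point, germs of good functions extend to a disc of fixed radius. -/
lemma exists_extension_of_notMem {z₀ : ℂ} (hz₀ : z₀ ∉ D.singularSet) :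
    ∃ r > 0, ∀ z₁ ∈ Metric.ball z₀ r, ∀ h : ℂ → ℂ, (∀ᶠ z in 𝓝 z₁, GoodAt D Ψ h z) →
      ∃ h', (∀ z ∈ Metric.ball z₀ r, GoodAt D Ψ h' z) ∧ h' =ᶠ[𝓝 z₁] h := by
  obtain ⟨r₁, hr₁, hs₁, h₁⟩ := hΨ.exists_sqrt hz₀
  obtain ⟨s, hs⟩ := IsAlgClosed.exists_pow_nat_eq (Ψ z₀) two_pos
  obtain ⟨hd, hsq, -⟩ := h₁ s hs
  set τ := sqrtBranch Ψ z₀ s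
  obtain ⟨r₂, hr₂, u₁, u₂, hu₁, hu₂, hW⟩ := exists_solvesLinear_basis (analyticAt_potential hz₀)
  have hb₁ : Metric.ball z₀ (min r₁ r₂) ⊆ Metric.ball z₀ r₁ :=
    Metric.ball_subset_ball (min_le_left _ _)
  have hb₂ : Metric.ball z₀ (min r₁ r₂) ⊆ Metric.ball z₀ r₂ :=
    Metric.ball_subset_ball (min_le_right _ _)
  refine ⟨min r₁ r₂, lt_min hr₁ hr₂, fun z₁ hz₁ h hh => ?_⟩
  obtain ⟨δ, hδ, hδb⟩ := Metric.mem_nhds_iff.mp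
    (Filter.inter_mem hh (Metric.isOpen_ball.mem_nhds hz₁))
  have hsub : Metric.ball z₁ δ ⊆ Metric.ball z₀ (min r₁ r₂) := fun z hz => (hδb hz).2
  have hsol := hΨ.solvesLinear_div (U := Metric.ball z₁ δ) Metric.isOpen_ball
    (fun z hz => hs₁ z (hb₁ (hsub hz))) (hd.mono (hsub.trans hb₁)) (fun z _ => hsq z)
    (fun z hz => (hδb hz).1)
  -- Near z₁ the solution h / τ is a combination of `u₁` and `u₂`; the same combination, multiplied
  -- by τ, is defined on the whole disc around z₀.
  obtain ⟨a, b, hab⟩ := hsol.exists_eq_lincomb Metric.isOpen_ball (convex_ball _ _).isPreconnected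
    (hu₁.mono (hsub.trans hb₂)) (hu₂.mono (hsub.trans hb₂)) (Metric.mem_ball_self hδ)
    (by rw [hW _ (hb₂ hz₁)]; exact one_ne_zero)
  have hlc := ((hu₁.mono hb₂).lincomb (hu₂.mono hb₂) Metric.isOpen_ball a b)
  refine ⟨_, fun z hz => hΨ.goodAt_mul Metric.isOpen_ball (fun z hz => hs₁ z (hb₁ hz))
    (hd.mono hb₁) (fun z _ => hsq z) hlc hz, ?_⟩
  filter_upwards [Metric.ball_mem_nhds z₁ hδ] with z hz
  have h0 : τ z ≠ 0 := fun e =>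
    hΨ.ne_zero z (hs₁ z (hb₁ (hsub hz))) (by rw [← hsq z, e]; ring)
  rw [← hab z hz]
  field_simp

end IsDivisorFunction

end GeneralizedLame

end

/-! ### Extension of good germs across the singular points and to the whole plane. -/

noncomputable section

namespace GeneralizedLame

variable {D : GeneralizedLame}

/-- `LogFreeAt` speaks of the representatives pᵢ only; periodicity of the potential carries it to
every point of the plane over a singular point. -/
lemma exists_logFree_of_mem_singularSet (hlog : D.LogFree) {z₀ : ℂ} (hz₀ : z₀ ∈ D.singularSet) :
    ∃ i, z₀ - D.p i ∈ D.L.lattice ∧ ∃ r > 0, ∀ z₁ ∈ Metric.ball z₀ r, z₁ ∉ D.singularSet →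
      ∀ u : ℂ → ℂ, ∀ U ∈ 𝓝 z₁, SolvesLinear D.potential u U →
        ∃ s g : ℂ → ℂ, AnalyticAt ℂ s z₁ ∧ (∀ᶠ z in 𝓝 z₁, s z ^ 2 = z - z₀) ∧
          DifferentiableOn ℂ g (Metric.ball z₀ r) ∧
          ∀ᶠ z in 𝓝 z₁, u z = (s z ^ D.ell i)⁻¹ * g z := by
  obtain ⟨i, hi⟩ := mem_singularSet.mp hz₀
  obtain ⟨r, hr, h⟩ := hlog i
  set l := z₀ - D.p i with hl
  refine ⟨i, hi, r, hr, fun z₁ hz₁ hs₁ u U hU hu => ?_⟩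
  obtain ⟨W, hWU, hWo, hzW⟩ := mem_nhds_iff.mp
    (Filter.inter_mem hU (isClosed_singularSet.isOpen_compl.mem_nhds hs₁))
  have hp : D.p i = z₀ - l := by rw [hl]; ring
  have hball : ∀ z, z ∈ Metric.ball z₀ r → z - l ∈ Metric.ball (D.p i) r := fun z hz => by
    rw [Metric.mem_ball, hp, dist_sub_right]; exact hz
  have hne : z₁ - l ≠ D.p i := fun e => hs₁ (by
    have : z₁ = D.p i + l := by rw [← e]; ring
    rw [this, add_mem_singularSet_iff hi]
    exact ⟨i, rfl⟩)
  have hsol : D.SolvesNear (fun z => u (z + l)) (z₁ - l) := by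
    refine ⟨(· + l) ⁻¹' W, hWo.preimage (by fun_prop), by simpa, ?_, fun z hz => ?_⟩
    · exact (hu.1.mono fun z hz => (hWU hz).1).comp (by fun_prop) fun z hz => hz
    · have e1 : deriv (fun z => u (z + l)) = fun z => deriv u (z + l) := by
        ext w; exact deriv_comp_add_const ..
      have hzs : z ∉ D.singularSet := fun hzs => (hWU hz).2 ((add_mem_singularSet_iff hi).mpr hzs)
      rw [e1, deriv_comp_add_const, hu.2 _ (hWU hz).1, potential_add hi hzs]
  obtain ⟨s, g, hsa, hs2, hg, he⟩ := h _ (hball z₁ hz₁) hne _ hsol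
  have ht : Filter.Tendsto (fun z => z - l) (𝓝 z₁) (𝓝 (z₁ - l)) :=
    (continuous_sub_right l).tendsto z₁
  refine ⟨fun z => s (z - l), fun z => g (z - l), hsa.fun_comp_of_eq (g := s) (f := fun z => z - l)
    (by fun_prop) rfl, ?_, ?_, ?_⟩
  · filter_upwards [ht.eventually hs2] with z hz
    rw [hz, hl]; ring
  · exact hg.comp (by fun_prop) hball
  · filter_upwards [ht.eventually he] with z hz
    rw [← hz, sub_add_cancel]

namespace IsDivisorFunction

variable {Ψ : ℂ → ℂ} (hΨ : IsDivisorFunction D Ψ)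
include hΨ

/-- If the equation is free from logarithms at a singular point, then germs of good functions
extend to a disc of fixed radius around that point. -/
lemma exists_extension_of_mem (hlog : D.LogFree) {z₀ : ℂ} (hz₀ : z₀ ∈ D.singularSet) :
    ∃ r > 0, ∀ z₁ ∈ Metric.ball z₀ r, z₁ ∉ D.singularSet →
      ∀ h : ℂ → ℂ, (∀ᶠ z in 𝓝 z₁, GoodAt D Ψ h z) →
      ∃ h', (∀ z ∈ Metric.ball z₀ r, GoodAt D Ψ h' z) ∧ h' =ᶠ[𝓝 z₁] h := by
  obtain ⟨i, hi, r₁, hr₁, h₁⟩ := exists_logFree_of_mem_singularSet hlog hz₀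
  obtain ⟨r₂, hr₂, h₂⟩ := exists_ball_singularSet (D := D) z₀
  obtain ⟨G, hG, hfac, hG0⟩ := hΨ.factor i z₀ hi
  have hGz : G z₀ ≠ 0 := fun e => (hG0 z₀ e).2 rfl
  obtain ⟨r₃, hr₃, h₃⟩ := exists_sqrtBranch_differentiableOn hG hGz
  obtain ⟨κ₀, hκ₀⟩ := IsAlgClosed.exists_pow_nat_eq (G z₀) two_pos
  have hκ := sqrtBranch_sq hGz hκ₀
  have hκd := h₃ κ₀
  set κ := sqrtBranch G z₀ κ₀
  set r := min r₁ (min r₂ r₃) with hr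
  have hb₁ : Metric.ball z₀ r ⊆ Metric.ball z₀ r₁ := Metric.ball_subset_ball (min_le_left _ _)
  have hb₂ : Metric.ball z₀ r ⊆ Metric.ball z₀ r₂ :=
    Metric.ball_subset_ball ((min_le_right _ _).trans (min_le_left _ _))
  have hb₃ : Metric.ball z₀ r ⊆ Metric.ball z₀ r₃ :=
    Metric.ball_subset_ball ((min_le_right _ _).trans (min_le_right _ _))
  refine ⟨r, lt_min hr₁ (lt_min hr₂ hr₃), fun z₁ hz₁ hs₁ h hh => ?_⟩
  obtain ⟨τ₀, hτ₀⟩ := IsAlgClosed.exists_pow_nat_eq (Ψ z₁) two_pos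
  obtain ⟨δ, hδ, hδs, hδτ⟩ := hΨ.exists_sqrt hs₁
  obtain ⟨hτd, hτ2, hτz⟩ := hδτ τ₀ hτ₀
  set τ := sqrtBranch Ψ z₁ τ₀
  have hτ0 : ∀ z ∈ Metric.ball z₁ δ, τ z ≠ 0 := fun z hz e =>
    hΨ.ne_zero z (hδs z hz) (by rw [← hτ2 z, e]; ring)
  obtain ⟨W, hWh, hWo, hzW⟩ := mem_nhds_iff.mp
    (Filter.inter_mem hh (Metric.ball_mem_nhds z₁ hδ))
  have hsol := hΨ.solvesLinear_div hWo (fun z hz => hδs z (hWh hz).2)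
    (hτd.mono fun z hz => (hWh hz).2) (fun z _ => hτ2 z) (fun z hz => (hWh hz).1)
  obtain ⟨s, g, hsa, hs2, hg, he⟩ := h₁ z₁ (hb₁ hz₁) hs₁ _ W (hWo.mem_nhds hzW) hsol
  have hτc : ContinuousAt τ z₁ :=
    (hτd.differentiableAt (Metric.ball_mem_nhds z₁ hδ)).continuousAt
  have hκc : ContinuousAt κ z₁ :=
    (hκd.differentiableAt (Metric.isOpen_ball.mem_nhds (hb₃ hz₁))).continuousAt
  -- By Ψ = (z - z₀) ^ ℓ G, both s ^ ℓ κ and τ are square roots of Ψ near z₁, hence equal up to a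
  -- sign ε. From h / τ = s ^ (-ℓ) g it follows that h = ε g κ, and the right-hand side is
  -- holomorphic on the full disc.
  set t : ℂ → ℂ := fun z => s z ^ D.ell i * κ z with ht
  have htc : ContinuousAt t z₁ := (hsa.continuousAt.pow _).mul hκc
  have ht2 : ∀ᶠ z in 𝓝 z₁, t z ^ 2 = τ z ^ 2 := by
    filter_upwards [hs2] with z hz
    simp only [ht]
    rw [hτ2, mul_pow, hκ, ← pow_mul, mul_comm (D.ell i), pow_mul, hz, hfac]
  have ht0 : t z₁ ≠ 0 := fun e => by
    have := ht2.self_of_nhds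
    rw [e] at this
    exact hτ0 z₁ (Metric.mem_ball_self hδ) (pow_eq_zero_iff two_ne_zero |>.mp (by
      rw [← this]; ring))
  have hsign : ∃ ε : ℂ, ε ^ 2 = 1 ∧ t =ᶠ[𝓝 z₁] fun z => ε * τ z := by
    rcases sq_eq_sq_iff_eq_or_eq_neg.mp ht2.self_of_nhds with e | e
    · refine ⟨1, by norm_num, ?_⟩
      simpa using eventuallyEq_of_sq_eq htc hτc ht2 e ht0
    · refine ⟨-1, by norm_num, ?_⟩
      have := eventuallyEq_of_sq_eq htc hτc.neg (by simpa using ht2) e ht0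
      filter_upwards [this] with z hz
      rw [hz, neg_one_mul, Pi.neg_apply]
  obtain ⟨ε, hε, htε⟩ := hsign
  have hgerm : (fun z => ε * (g z * κ z)) =ᶠ[𝓝 z₁] h := by
    filter_upwards [he, htε, Metric.ball_mem_nhds z₁ hδ, htc.eventually_ne ht0]
      with z hz1 hz2 hz3 hz4
    have h0 := hτ0 z hz3
    have hs0 : s z ^ D.ell i ≠ 0 := fun e => hz4 (by simp only [ht, e, zero_mul])
    simp only [ht] at hz2
    rw [div_eq_iff h0] at hz1
    have hg' : g z * τ z = h z * s z ^ D.ell i := by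
      rw [hz1]; field_simp
    have : g z * κ z * s z ^ D.ell i = ε * (h z * s z ^ D.ell i) := by
      rw [← hg']; linear_combination g z * hz2
    have h' : g z * κ z = ε * h z := mul_right_cancel₀ hs0 (by rw [this]; ring)
    rw [h', ← mul_assoc, ← sq, hε, one_mul]
  set h' : ℂ → ℂ := fun z => ε * (g z * κ z)
  have hd' : DifferentiableOn ℂ h' (Metric.ball z₀ r) :=
    ((hg.mono hb₁).mul (hκd.mono hb₃)).const_mul ε
  have han : ∀ z ∈ Metric.ball z₀ r, AnalyticAt ℂ h' z := fun z hz =>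
    hd'.analyticAt (Metric.isOpen_ball.mem_nhds hz)
  refine ⟨h', fun z hz => ⟨han z hz, fun hzs => ?_⟩, hgerm⟩
  have hreg : ∀ z ∈ Metric.ball z₀ r \ {z₀}, z ∉ D.singularSet := fun z hz hs =>
    hz.2 (h₂ z (hb₂ hz.1) hs)
  have hl : AnalyticOnNhd ℂ (deriv (deriv h')) (Metric.ball z₀ r \ {z₀}) := fun z hz =>
    (han z hz.1).deriv.deriv
  have hr : AnalyticOnNhd ℂ (fun z => logDeriv Ψ z * deriv h' z +
      (D.potential z + deriv (logDeriv Ψ) z / 2 - logDeriv Ψ z ^ 2 / 4) * h' z)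
      (Metric.ball z₀ r \ {z₀}) := fun z hz => by
    have h1 := hΨ.analyticAt_logDeriv (hreg z hz)
    have h2 := analyticAt_potential (hreg z hz)
    exact (h1.mul (han z hz.1).deriv).add
      (((h2.add (h1.deriv.div_const)).sub ((h1.pow 2).div_const)).mul (han z hz.1))
  have hne : ∀ z ∉ D.singularSet, z ≠ z₀ := fun z hz e => hz (e ▸ hz₀)
  -- The equation holds near z₁, and both of its sides are analytic on the connected punctured disc.
  refine hl.eqOn_of_preconnected_of_eventuallyEq hr (isPreconnected_ball_sdiff_singleton z₀ r)
    ⟨hz₁, hne z₁ hs₁⟩ ?_ ⟨hz, hne z hzs⟩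
  filter_upwards [hh, hgerm.eventuallyEq_nhds,
    isClosed_singularSet.isOpen_compl.mem_nhds hs₁] with w hw1 hw2 hw3
  exact (hw1.congr hw2).2 hw3

lemma exists_extension (hlog : D.LogFree) (z₀ : ℂ) :
    ∃ r > 0, ∀ z₁ ∈ Metric.ball z₀ r, z₁ ∉ D.singularSet →
      ∀ h : ℂ → ℂ, (∀ᶠ z in 𝓝 z₁, GoodAt D Ψ h z) →
      ∃ h', (∀ z ∈ Metric.ball z₀ r, GoodAt D Ψ h' z) ∧ h' =ᶠ[𝓝 z₁] h := by
  by_cases hz₀ : z₀ ∈ D.singularSet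
  · exact hΨ.exists_extension_of_mem hlog hz₀
  · obtain ⟨r, hr, h⟩ := hΨ.exists_extension_of_notMem hz₀
    exact ⟨r, hr, fun z₁ hz₁ _ => h z₁ hz₁⟩

omit hΨ in
lemma _root_.GeneralizedLame.eqOn_of_goodAt {h h' : ℂ → ℂ} {U : Set ℂ} (hU : IsPreconnected U)
    (hh : ∀ z ∈ U, GoodAt D Ψ h z) (hh' : ∀ z ∈ U, GoodAt D Ψ h' z) {z₁ : ℂ} (hz₁ : z₁ ∈ U)
    (he : h =ᶠ[𝓝 z₁] h') : Set.EqOn h h' U :=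
  AnalyticOnNhd.eqOn_of_preconnected_of_eventuallyEq (fun z hz => (hh z hz).1)
    (fun z hz => (hh' z hz).1) hU hz₁ he

omit hΨ in
/-- If germs of good functions extend to discs of radius `δ` around the points of a circle, then
a good function on the disc bounded by this circle extends to a concentric disc whose radius is
larger by `δ`. -/
lemma exists_goodAt_ball_add {c : ℂ} {ρ δ : ℝ} (hρ : 0 < ρ)
    (hδ : 0 < δ) (hext : ∀ ζ ∈ Metric.sphere c ρ, ∀ z₁ ∈ Metric.ball ζ δ, z₁ ∉ D.singularSet →
      ∀ h : ℂ → ℂ, (∀ᶠ z in 𝓝 z₁, GoodAt D Ψ h z) →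
      ∃ h', (∀ z ∈ Metric.ball ζ δ, GoodAt D Ψ h' z) ∧ h' =ᶠ[𝓝 z₁] h)
    {h : ℂ → ℂ} (hh : ∀ z ∈ Metric.ball c ρ, GoodAt D Ψ h z) :
    ∃ h', (∀ z ∈ Metric.ball c (ρ + δ), GoodAt D Ψ h' z) ∧
      Set.EqOn h' h (Metric.ball c ρ) := by
  have hconv : ∀ ζ, IsPreconnected (Metric.ball ζ δ ∩ Metric.ball c ρ) := fun ζ =>
    ((convex_ball ζ δ).inter (convex_ball c ρ)).isPreconnected
  have hloc : ∀ ζ ∈ Metric.sphere c ρ, ∃ h', (∀ z ∈ Metric.ball ζ δ, GoodAt D Ψ h' z) ∧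
      Set.EqOn h' h (Metric.ball ζ δ ∩ Metric.ball c ρ) := by
    intro ζ hζ
    have hne : (Metric.ball ζ δ ∩ Metric.ball c ρ).Nonempty := by
      have : ζ ∈ closure (Metric.ball c ρ) := by
        rw [closure_ball c hρ.ne']; exact Metric.sphere_subset_closedBall hζ
      exact mem_closure_iff.mp this _ Metric.isOpen_ball (Metric.mem_ball_self hδ)
    -- The hypothesis `hext` needs a starting point outside the singular set; such points are dense
    -- because the set is countable.
    have hdense : Dense (D.singularSetᶜ) := countable_singularSet.dense_compl ℂ
    obtain ⟨z₁, hz₁, hs₁⟩ := hdense.inter_open_nonempty _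
      (Metric.isOpen_ball.inter Metric.isOpen_ball) hne
    obtain ⟨h', hg, he⟩ := hext ζ hζ z₁ hz₁.1 hs₁ h
      (Filter.mem_of_superset (Metric.isOpen_ball.mem_nhds hz₁.2) hh)
    exact ⟨h', hg, eqOn_of_goodAt (hconv ζ) (fun z hz => hg z hz.1) (fun z hz => hh z hz.2) hz₁ he⟩
  choose! H hHg hHe using hloc
  have hcomp : ∀ ζ ∈ Metric.sphere c ρ, ∀ ζ' ∈ Metric.sphere c ρ,
      ∀ z ∈ Metric.ball ζ δ ∩ Metric.ball ζ' δ, H ζ z = H ζ' z := by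
    intro ζ hζ ζ' hζ' z hz
    rcases eq_or_ne ζ ζ' with rfl | hne
    · rfl
    -- The midpoint of ζ and ζ' lies strictly inside the disc, since they are distinct points of its
    -- boundary circle. It lies within δ of both, since their δ-balls meet. At m both extensions
    -- agree with `h`, so they agree on the convex intersection of the two balls.
    set m := c + (1 / 2 : ℝ) • ((ζ - c) + (ζ' - c)) with hm
    have hn : ‖ζ - c‖ = ρ := by rw [← dist_eq_norm]; exact hζ
    have hn' : ‖ζ' - c‖ = ρ := by rw [← dist_eq_norm]; exact hζ'
    have hmc : m ∈ Metric.ball c ρ := by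
      rw [Metric.mem_ball, dist_eq_norm, hm, add_sub_cancel_left, ← hn]
      exact (norm_midpoint_lt_iff (hn.trans hn'.symm)).mpr fun e => hne (sub_left_injective e)
    have hdist : dist ζ ζ' < 2 * δ := by
      calc dist ζ ζ' ≤ dist ζ z + dist z ζ' := dist_triangle _ _ _
        _ < δ + δ := add_lt_add (by rw [dist_comm]; exact hz.1) hz.2
        _ = 2 * δ := by ring
    have hmζ : m ∈ Metric.ball ζ δ := by
      have : m - ζ = (1 / 2 : ℝ) • (ζ' - ζ) := by
        rw [hm, Complex.real_smul, Complex.real_smul]; push_cast; ring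
      rw [Metric.mem_ball, dist_eq_norm, this, norm_smul, ← dist_eq_norm, dist_comm]
      norm_num; linarith
    have hmζ' : m ∈ Metric.ball ζ' δ := by
      have : m - ζ' = (1 / 2 : ℝ) • (ζ - ζ') := by
        rw [hm, Complex.real_smul, Complex.real_smul]; push_cast; ring
      rw [Metric.mem_ball, dist_eq_norm, this, norm_smul, ← dist_eq_norm]
      norm_num; linarith
    refine eqOn_of_goodAt (D := D) (Ψ := Ψ)
      ((convex_ball ζ δ).inter (convex_ball ζ' δ)).isPreconnected
      (fun z hz => hHg ζ hζ z hz.1) (fun z hz => hHg ζ' hζ' z hz.2) ⟨hmζ, hmζ'⟩ ?_ hz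
    filter_upwards [Metric.isOpen_ball.mem_nhds hmζ, Metric.isOpen_ball.mem_nhds hmζ',
      Metric.isOpen_ball.mem_nhds hmc] with w hw1 hw2 hw3
    rw [hHe ζ hζ ⟨hw1, hw3⟩, hHe ζ' hζ' ⟨hw2, hw3⟩]
  -- Radial projection to the circle: a point outside the disc but inside the larger one is within δ
  -- of its projection, which selects the local extension used there.
  set pr : ℂ → ℂ := fun z => c + (ρ / ‖z - c‖ : ℝ) • (z - c) with hpr
  classical
  set h' : ℂ → ℂ := fun z => if z ∈ Metric.ball c ρ then h z else H (pr z) z with hh'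
  have hprs : ∀ z ∉ Metric.ball c ρ, pr z ∈ Metric.sphere c ρ ∧ dist z (pr z) = dist z c - ρ := by
    intro z hz
    rw [Metric.mem_ball, not_lt, dist_eq_norm] at hz
    have hz0 : 0 < ‖z - c‖ := hρ.trans_le hz
    constructor
    · rw [mem_sphere_iff_norm, hpr]
      simp only [add_sub_cancel_left]
      rw [norm_smul, Real.norm_of_nonneg (by positivity)]
      field_simp
    · have : z - pr z = (1 - ρ / ‖z - c‖ : ℝ) • (z - c) := by
        rw [hpr, sub_smul, one_smul]; ring
      rw [dist_eq_norm, dist_eq_norm, this, norm_smul, Real.norm_of_nonneg (by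
        rw [sub_nonneg]; exact (div_le_one hz0).mpr hz)]
      field_simp
  have hEq : ∀ ζ ∈ Metric.sphere c ρ, Set.EqOn h' (H ζ) (Metric.ball ζ δ ∩ Metric.ball c (ρ + δ)) := by
    intro ζ hζ z hz
    simp only [hh']
    split_ifs with hzc
    · exact (hHe ζ hζ ⟨hz.1, hzc⟩).symm
    · obtain ⟨h1, h2⟩ := hprs z hzc
      refine hcomp _ h1 ζ hζ z ⟨?_, hz.1⟩
      have := Metric.mem_ball.mp hz.2
      rw [Metric.mem_ball, h2]; linarith
  refine ⟨h', fun z hz => ?_, fun z hz => if_pos hz⟩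
  by_cases hzc : z ∈ Metric.ball c ρ
  · refine (hh z hzc).congr ?_
    filter_upwards [Metric.isOpen_ball.mem_nhds hzc] with w hw using if_pos hw
  · obtain ⟨h1, h2⟩ := hprs z hzc
    have hzb : z ∈ Metric.ball (pr z) δ := by
      have := Metric.mem_ball.mp hz
      rw [Metric.mem_ball, h2]; linarith
    refine (hHg _ h1 z hzb).congr ?_
    filter_upwards [(Metric.isOpen_ball.inter Metric.isOpen_ball).mem_nhds ⟨hzb, hz⟩] with w hw
    exact hEq _ h1 hw

/-- Every germ of a good function at a regular point extends to an entire good function. -/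
theorem exists_entire_extension (hlog : D.LogFree) {c : ℂ} {h : ℂ → ℂ}
    (hh : ∀ᶠ z in 𝓝 c, GoodAt D Ψ h z) :
    ∃ H, (∀ z, GoodAt D Ψ H z) ∧ H =ᶠ[𝓝 c] h := by
  obtain ⟨ρ₀, hρ₀, h₀⟩ := Metric.eventually_nhds_iff_ball.mp hh
  have hbig : ∀ R ≥ ρ₀, ∃ h', (∀ z ∈ Metric.ball c R, GoodAt D Ψ h' z) ∧
      Set.EqOn h' h (Metric.ball c ρ₀) := by
    intro R hR₀
    choose r hr hext using hΨ.exists_extension hlog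
    -- A Lebesgue number gives one extension radius δ for all centres in the closed disc of radius
    -- R, so finitely many enlargements reach R. The cap `min R` below keeps the centres in this
    -- disc.
    obtain ⟨δ, hδ, hleb⟩ := lebesgue_number_lemma_of_metric (isCompact_closedBall c R)
      (fun z₀ => Metric.isOpen_ball (x := z₀) (ε := r z₀))
      (fun z _ => Set.mem_iUnion.mpr ⟨z, Metric.mem_ball_self (hr z)⟩)
    have hstep : ∀ n : ℕ, ∃ h', (∀ z ∈ Metric.ball c (min R (ρ₀ + n * δ)), GoodAt D Ψ h' z) ∧
        Set.EqOn h' h (Metric.ball c ρ₀) := by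
      intro n
      induction n with
      | zero =>
        exact ⟨h, fun z hz => h₀ z (Metric.ball_subset_ball ((min_le_right _ _).trans (by simp)) hz),
          fun z _ => rfl⟩
      | succ n ih =>
        obtain ⟨h', hg, he⟩ := ih
        rcases le_or_gt R (ρ₀ + n * δ) with hR | hR
        · refine ⟨h', fun z hz => hg z (Metric.ball_subset_ball ?_ hz), he⟩
          rw [min_eq_left hR]; exact min_le_left _ _
        · rw [min_eq_right hR.le] at hg
          have hpos : 0 < ρ₀ + n * δ := by positivity
          obtain ⟨h'', hg'', he''⟩ := exists_goodAt_ball_add (D := D) (Ψ := Ψ) hpos hδ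
            (fun ζ hζ z₁ hz₁ hs₁ k hk => by
              obtain ⟨z₀, hz₀⟩ := hleb ζ (Metric.sphere_subset_closedBall.trans
                (Metric.closedBall_subset_closedBall hR.le) hζ)
              obtain ⟨k', hk', hke⟩ := hext z₀ z₁ (hz₀ hz₁) hs₁ k hk
              exact ⟨k', fun z hz => hk' z (hz₀ hz), hke⟩) hg
          refine ⟨h'', fun z hz => hg'' z (Metric.ball_subset_ball ?_ hz), fun z hz => ?_⟩
          · refine (min_le_right _ _).trans (le_of_eq ?_); push_cast; ring
          · rw [he'' (Metric.ball_subset_ball (by simp; positivity) hz), he hz]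
    obtain ⟨n, hn⟩ := exists_nat_ge (R / δ)
    have hn' : R ≤ n * δ := (div_le_iff₀ hδ).mp hn
    obtain ⟨h', hg, he⟩ := hstep n
    rw [min_eq_left (by linarith)] at hg
    exact ⟨h', hg, he⟩
  have hbig' : ∀ n : ℕ, ∃ h', (∀ z ∈ Metric.ball c (ρ₀ + n), GoodAt D Ψ h' z) ∧
      Set.EqOn h' h (Metric.ball c ρ₀) := fun n => hbig _ (by simp)
  choose H hHg hHe using hbig'
  have hcompat : ∀ m n : ℕ, ∀ z ∈ Metric.ball c (ρ₀ + m), z ∈ Metric.ball c (ρ₀ + n) →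
      H m z = H n z := by
    intro m n z hzm hzn
    have hb : ∀ k : ℕ, c ∈ Metric.ball c (ρ₀ + k) := fun k => Metric.mem_ball_self (by positivity)
    refine eqOn_of_goodAt (D := D) (Ψ := Ψ)
      ((convex_ball c (ρ₀ + m)).inter (convex_ball c (ρ₀ + n))).isPreconnected
      (fun z hz => hHg m z hz.1) (fun z hz => hHg n z hz.2) ⟨hb m, hb n⟩ ?_ ⟨hzm, hzn⟩
    filter_upwards [Metric.ball_mem_nhds c hρ₀] with w hw
    rw [hHe m hw, hHe n hw]
  have hmem : ∀ z, z ∈ Metric.ball c (ρ₀ + ⌈dist z c⌉₊) := fun z => by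
    rw [Metric.mem_ball]; linarith [Nat.le_ceil (dist z c)]
  have hEq : ∀ n : ℕ, ∀ z ∈ Metric.ball c (ρ₀ + n), H ⌈dist z c⌉₊ z = H n z := fun n z hz =>
    hcompat _ _ z (hmem z) hz
  -- The extensions to larger and larger discs are compatible; at z the one of index ⌈dist z c⌉ is
  -- defined.
  refine ⟨fun z => H ⌈dist z c⌉₊ z, fun z => (hHg _ z (hmem z)).congr ?_, ?_⟩
  · filter_upwards [Metric.isOpen_ball.mem_nhds (hmem z)] with w hw using hEq _ w hw
  · filter_upwards [Metric.ball_mem_nhds c hρ₀] with w hw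
    rw [hEq 0 w (by simpa using hw), hHe 0 hw]

end IsDivisorFunction

end GeneralizedLame

end

/-! ### Analytic continuation on the punctured torus and lifting of paths. -/

noncomputable section

namespace GeneralizedLame

variable {D : GeneralizedLame}

section Projection

variable (D)

lemma isAddQuotientCoveringMap_proj :
    IsAddQuotientCoveringMap D.proj D.L.lattice.toAddSubgroup :=
  AddSubgroup.isAddQuotientCoveringMap_of_comm D.L.lattice.toAddSubgroup
    ⟨inferInstanceAs (DiscreteTopology D.L.lattice)⟩

lemma isCoveringMap_proj : IsCoveringMap D.proj := D.isAddQuotientCoveringMap_proj.isCoveringMap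

lemma isOpenQuotientMap_proj : IsOpenQuotientMap D.proj :=
  D.isAddQuotientCoveringMap_proj.isOpenQuotientMap

lemma continuous_proj : Continuous D.proj := D.isOpenQuotientMap_proj.continuous

lemma surjective_proj : Function.Surjective D.proj := D.isOpenQuotientMap_proj.surjective

variable {D}

lemma eventually_nhds_proj {z : ℂ} {P : D.Torus → Prop} :
    (∀ᶠ y in 𝓝 (D.proj z), P y) ↔ ∀ᶠ w in 𝓝 z, P (D.proj w) := by
  rw [← D.isOpenQuotientMap_proj.map_nhds_eq, Filter.eventually_map]

lemma notMem_singularSet_iff {z : ℂ} :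
    z ∉ D.singularSet ↔ ∀ i, D.proj z ≠ D.proj (D.p i) := by
  simp [singularSet]

variable (D) in
lemma exists_injOn_proj : ∃ r > 0, ∀ z₀ : ℂ, Set.InjOn D.proj (Metric.ball z₀ r) := by
  have h : ((D.L.lattice : Set ℂ) \ {0})ᶜ ∈ 𝓝 (0 : ℂ) := D.L.compl_lattice_sdiff_singleton_mem_nhds 0
  obtain ⟨r, hr, h⟩ := Metric.mem_nhds_iff.mp h
  refine ⟨r / 2, half_pos hr, fun z₀ z hz w hw he => ?_⟩
  by_contra hne
  refine h (a := z - w) ?_ ⟨D.proj_eq_iff.mp he, fun e => hne (sub_eq_zero.mp e)⟩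
  rw [mem_ball_zero_iff, ← dist_eq_norm]
  calc dist z w ≤ dist z z₀ + dist w z₀ := dist_triangle_right _ _ _
    _ < r / 2 + r / 2 := add_lt_add hz hw
    _ = r := by ring

/-- The function on the torus which is obtained from a function in the plane near `z₀`, by means
of the local inverse of the projection at `z₀`. -/
def pushforward (D : GeneralizedLame) (f : ℂ → ℂ) (z₀ : ℂ) (y : D.Torus) : ℂ :=
  f (Function.invFunOn D.proj (Metric.ball z₀ D.exists_injOn_proj.choose) y)

lemma pushforward_proj (f : ℂ → ℂ) (z₀ : ℂ) :
    (fun z => pushforward D f z₀ (D.proj z)) =ᶠ[𝓝 z₀] f := by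
  obtain ⟨hr, h⟩ := D.exists_injOn_proj.choose_spec
  filter_upwards [Metric.ball_mem_nhds z₀ hr] with z hz
  exact congrArg f ((h z₀).leftInvOn_invFunOn hz)

/-- `IsSolutionNear` requires the equation on a full preimage, a union of lattice translates of one
neighbourhood. Periodicity of the potential and of w ∘ proj reduces this to a single sheet. -/
lemma isSolutionNear_proj_iff {w : D.Torus → ℂ} {z : ℂ} (hz : z ∉ D.singularSet) :
    IsSolutionNear w (D.proj z) ↔
      ∃ U ∈ 𝓝 z, SolvesLinear D.potential (fun z => w (D.proj z)) U := by
  constructor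
  · rintro ⟨U, hU, hzU, h⟩
    exact ⟨_, D.continuous_proj.continuousAt.preimage_mem_nhds (hU.mem_nhds hzU), h⟩
  · rintro ⟨U, hU, h⟩
    obtain ⟨W, hWU, hWo, hzW⟩ := mem_nhds_iff.mp
      (Filter.inter_mem hU (isClosed_singularSet.isOpen_compl.mem_nhds hz))
    refine ⟨D.proj '' W, D.isOpenQuotientMap_proj.isOpenMap W hWo, ⟨z, hzW, rfl⟩, ?_⟩
    set u : ℂ → ℂ := fun z => w (D.proj z) with hu
    have key : ∀ y ∈ D.proj ⁻¹' (D.proj '' W), DifferentiableAt ℂ u y ∧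
        deriv (deriv u) y = D.potential y * u y := by
      rintro y ⟨v, hv, hvy⟩
      have hl : y - v ∈ D.L.lattice := D.proj_eq_iff.mp hvy.symm
      set l := y - v with hl'
      have hy : y = v + l := by rw [hl']; ring
      have hper : ∀ a, u (a + l) = u a := fun a => by simp only [hu, D.proj_add hl]
      have hper' : (fun a => u (a + l)) = u := funext hper
      have hvs : v ∉ D.singularSet := (hWU hv).2
      have hdv : DifferentiableAt ℂ u v :=
        (h.1.mono fun a ha => (hWU ha).1).differentiableAt (hWo.mem_nhds hv)
      constructor
      · have : DifferentiableAt ℂ (fun a => u (a - l)) y := by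
          refine DifferentiableAt.comp y (g := u) (f := fun a => a - l) ?_ (by fun_prop)
          rw [hy, add_sub_cancel_right]; exact hdv
        have e : (fun a => u (a - l)) = u := by
          ext a; rw [← hper (a - l), sub_add_cancel]
        rwa [e] at this
      · have e1 : ∀ a, deriv u (a + l) = deriv u a := fun a => by
          rw [← deriv_comp_add_const, hper']
        have e2 : deriv (deriv u) (v + l) = deriv (deriv u) v := by
          rw [← deriv_comp_add_const, funext e1]
        rw [hy, e2, h.2 v (hWU hv).1, hper, potential_add hl hvs]
    exact ⟨fun y hy => (key y hy).1.differentiableWithinAt, fun y hy => (key y hy).2⟩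

end Projection

section Continuation

/-- Analytic continuation along a path is unique. -/
theorem IsContinuation.eventuallyEq {x y : D.PuncturedTorus} {γ : Path x y}
    {W W' : I → D.Torus → ℂ} (h : IsContinuation γ W) (h' : IsContinuation γ W')
    (h0 : W 0 =ᶠ[𝓝 x.1] W' 0) : W 1 =ᶠ[𝓝 y.1] W' 1 := by
  have hγ : Continuous fun t => (γ t).1 := continuous_subtype_val.comp γ.continuous
  -- The parameters at which the two germs agree form a set that is open and closed in I. Closedness
  -- is the identity theorem on a disc where both elements at time t are holomorphic.
  set S : Set I := {t | W t =ᶠ[𝓝 (γ t).1] W' t} with hS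
  have hopen : IsOpen S := by
    rw [isOpen_iff_mem_nhds]
    intro t ht
    have h1 : ∀ᶠ s in 𝓝 t, W t =ᶠ[𝓝 (γ s).1] W' t :=
      hγ.continuousAt.eventually (Filter.EventuallyEq.eventuallyEq_nhds ht)
    filter_upwards [h1, h.2 t, h'.2 t] with s hs1 hs2 hs3
    exact (hs2.trans hs1).trans hs3.symm
  have hclosed : IsClosed S := by
    rw [isClosed_iff_frequently]
    intro t ht
    obtain ⟨z, hz⟩ := D.surjective_proj (γ t).1
    have hzs : z ∉ D.singularSet := notMem_singularSet_iff.mpr fun i => by rw [hz]; exact (γ t).2 i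
    have h1 := h.1 t
    have h2 := h'.1 t
    rw [← hz, isSolutionNear_proj_iff hzs] at h1 h2
    obtain ⟨U, hU, hu⟩ := h1
    obtain ⟨U', hU', hu'⟩ := h2
    obtain ⟨ε, hε, hb⟩ := Metric.mem_nhds_iff.mp (Filter.inter_mem hU hU')
    have himg : D.proj '' Metric.ball z ε ∈ 𝓝 (γ t).1 := by
      rw [← hz]
      exact D.isOpenQuotientMap_proj.isOpenMap.image_mem_nhds (Metric.ball_mem_nhds z hε)
    obtain ⟨s, hsS, hs1, hs2, v, hv, hvs⟩ :=
      (ht.and_eventually ((h.2 t).and ((h'.2 t).and (hγ.continuousAt.eventually himg)))).exists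
    have hge : W t =ᶠ[𝓝 (γ s).1] W' t := (hs1.symm.trans hsS).trans hs2
    rw [← hvs] at hge
    have hge' := eventually_nhds_proj.mp hge
    have heq := AnalyticOnNhd.eqOn_of_preconnected_of_eventuallyEq
      ((hu.1.mono fun a ha => (hb ha).1).analyticOnNhd Metric.isOpen_ball)
      ((hu'.1.mono fun a ha => (hb ha).2).analyticOnNhd Metric.isOpen_ball)
      (convex_ball z ε).isPreconnected hv hge'
    rw [hS, Set.mem_ofPred_eq, ← hz]
    refine eventually_nhds_proj.mpr ?_
    filter_upwards [Metric.ball_mem_nhds z hε] with a ha using heq ha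
  have huniv : S = Set.univ := IsClopen.eq_univ ⟨hclosed, hopen⟩ ⟨0, by
    rw [hS, Set.mem_ofPred_eq, γ.source]; exact h0⟩
  have : (1 : I) ∈ S := huniv ▸ Set.mem_univ _
  rwa [hS, Set.mem_ofPred_eq, γ.target] at this

namespace IsDivisorFunction

variable {Ψ : ℂ → ℂ} (hΨ : IsDivisorFunction D Ψ)
include hΨ

/-- Explicit analytic continuation: along the projection of a path `α` in the plane, the quotient
of an entire good function by the square root of `Ψ` is continued by following the square root. -/
theorem exists_isContinuation {x y : D.PuncturedTorus} {γ : Path x y} {α s : I → ℂ}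
    (hα : Continuous α) (hs : Continuous s) (hαγ : ∀ t, D.proj (α t) = (γ t).1)
    (hsα : ∀ t, s t ^ 2 = Ψ (α t)) {H : ℂ → ℂ} (hH : ∀ z, GoodAt D Ψ H z) :
    ∃ W, IsContinuation γ W ∧ ∀ t, (fun z => W t (D.proj z)) =ᶠ[𝓝 (α t)]
      fun z => H z / sqrtBranch Ψ (α t) (s t) z := by
  have hreg : ∀ t, α t ∉ D.singularSet := fun t =>
    notMem_singularSet_iff.mpr fun i => by rw [hαγ]; exact (γ t).2 i
  set F : I → ℂ → ℂ := fun t z => H z / sqrtBranch Ψ (α t) (s t) z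
  refine ⟨fun t => pushforward D (F t) (α t), ⟨fun t => ?_, fun t => ?_⟩,
    fun t => pushforward_proj _ _⟩
  · rw [← hαγ t, isSolutionNear_proj_iff (hreg t)]
    obtain ⟨r, hr, hrs, hb⟩ := hΨ.exists_sqrt (hreg t)
    obtain ⟨hd, hsq, -⟩ := hb _ (hsα t)
    have hsol := hΨ.solvesLinear_div Metric.isOpen_ball hrs hd (fun z _ => hsq z)
      (fun z _ => hH z)
    obtain ⟨W, hW, hWo, hzW⟩ := mem_nhds_iff.mp
      (Filter.inter_mem (pushforward_proj (F t) (α t)) (Metric.ball_mem_nhds (α t) hr))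
    exact ⟨W, hWo.mem_nhds hzW, (hsol.mono fun z hz => (hW hz).2).congr hWo fun z hz => (hW hz).1⟩
  · obtain ⟨r, hr, hrs, hb⟩ := hΨ.exists_sqrt (hreg t)
    obtain ⟨hd, hsq, hself⟩ := hb _ (hsα t)
    set τ := sqrtBranch Ψ (α t) (s t) with hτ
    have hτc : ContinuousAt τ (α t) :=
      (hd.differentiableAt (Metric.ball_mem_nhds _ hr)).continuousAt
    have hs0 : s t ≠ 0 := fun e => hΨ.ne_zero _ (hreg t) (by rw [← hsα t, e]; ring)
    -- Near t the continuous root s follows the branch τ chosen at t, since both are square roots of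
    -- Ψ ∘ α with the same nonzero value at t. Hence the branches chosen at t' and at t have the
    -- same germ at α t'.
    have h1 : s =ᶠ[𝓝 t] fun t' => τ (α t') := by
      refine eventuallyEq_of_sq_eq hs.continuousAt
        (ContinuousAt.comp (g := τ) hτc hα.continuousAt) ?_ hself.symm hs0
      exact .of_forall fun t' => by rw [hsα, hsq]
    have h2 : ∀ᶠ t' in 𝓝 t, α t' ∈ Metric.ball (α t) r :=
      hα.continuousAt.eventually (Metric.ball_mem_nhds _ hr)
    have h3 : ∀ᶠ t' in 𝓝 t, (fun z => pushforward D (F t) (α t) (D.proj z)) =ᶠ[𝓝 (α t')] F t :=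
      hα.continuousAt.eventually (pushforward_proj (F t) (α t)).eventuallyEq_nhds
    filter_upwards [h1, h2, h3] with t' ht1 ht2 ht3
    rw [← hαγ t']
    refine eventually_nhds_proj.mpr ?_
    obtain ⟨r', hr', hrs', hb'⟩ := hΨ.exists_sqrt (hreg t')
    obtain ⟨hd', hsq', hself'⟩ := hb' _ (hsα t')
    have hbr : sqrtBranch Ψ (α t') (s t') =ᶠ[𝓝 (α t')] τ := by
      refine eventuallyEq_of_sq_eq
        (hd'.differentiableAt (Metric.ball_mem_nhds _ hr')).continuousAt
        (hd.differentiableAt (Metric.isOpen_ball.mem_nhds ht2)).continuousAt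
        (.of_forall fun z => by rw [hsq', hsq]) (by rw [hself', ht1]) ?_
      rw [hself']
      exact fun e => hΨ.ne_zero _ (hreg t') (by rw [← hsα t', e]; ring)
    filter_upwards [pushforward_proj (F t') (α t'), ht3, hbr] with z hz1 hz2 hz3
    rw [hz1, hz2]
    simp only [F, hz3, hτ]

end IsDivisorFunction

end Continuation

section Lift

lemma exists_lift {x y : D.PuncturedTorus} (γ : Path x y) {z : ℂ} (hz : D.proj z = x.1) :
    ∃ α : C(I, ℂ), α 0 = z ∧ ∀ t, D.proj (α t) = (γ t).1 := by
  let f : C(I, D.Torus) := ⟨fun t => (γ t).1, continuous_subtype_val.comp γ.continuous⟩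
  have h0 : f 0 = D.proj z := by simp [f, hz]
  refine ⟨D.isCoveringMap_proj.liftPath f z h0, D.isCoveringMap_proj.liftPath_zero .., fun t => ?_⟩
  exact congr_fun (D.isCoveringMap_proj.liftPath_lifts f z h0) t

/-- Squaring is a covering map over ℂ \ {0}, so maps from a simply connected, locally path connected
space lift. -/
lemma exists_sqrt_lift {A : Type*} [TopologicalSpace A] [SimplyConnectedSpace A]
    [LocallyPathConnectedSpace A] (f : C(A, ℂ)) (hf : ∀ a, f a ≠ 0) {a₀ : A} {s₀ : ℂ}
    (hs₀ : s₀ ^ 2 = f a₀) : ∃ s : C(A, ℂ), s a₀ = s₀ ∧ ∀ a, s a ^ 2 = f a := by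
  obtain ⟨s, ⟨h1, h2⟩, -⟩ := (isCoveringMapOn_npow (𝕜 := ℂ) 2 (by norm_num)).existsUnique_continuousMap_lifts
    f hs₀ fun a => hf a
  exact ⟨s, h1, fun a => congr_fun h2 a⟩

lemma exists_sqrt_path (f : C(I, ℂ)) (hf : ∀ t, f t ≠ 0) {s₀ : ℂ} (hs₀ : s₀ ^ 2 = f 0) :
    ∃ s : C(I, ℂ), s 0 = s₀ ∧ ∀ t, s t ^ 2 = f t := by
  -- The path is extended to ℝ by constants, and the root is restricted to I afterwards.
  obtain ⟨s, hs0, hs⟩ := exists_sqrt_lift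
    (f.comp ⟨Set.projIcc (0 : ℝ) 1 zero_le_one, continuous_projIcc⟩) (fun _ => hf _)
    (a₀ := 0) (s₀ := s₀) (by simpa using hs₀)
  refine ⟨s.comp ⟨Subtype.val, continuous_subtype_val⟩, by simpa using hs0, fun t => ?_⟩
  have := hs t
  simpa using this

end Lift

end GeneralizedLame

end

/-! ### The action of lattice translations on entire good functions, and the monodromy matrices. -/

noncomputable section

namespace GeneralizedLame

variable {D : GeneralizedLame}

/-- `h 0`, `h 1` is a basis of the space of entire good functions. -/
structure IsGoodBasis (D : GeneralizedLame) (Ψ : ℂ → ℂ) (h : Fin 2 → ℂ → ℂ) : Prop where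
  goodAt : ∀ k z, GoodAt D Ψ (h k) z
  span : ∀ H, (∀ z, GoodAt D Ψ H z) → ∃ c : Fin 2 → ℂ, ∀ z, H z = ∑ k, c k * h k z
  indep : ∀ c : Fin 2 → ℂ, (∀ z, ∑ k, c k * h k z = 0) → c = 0

/-- If the Wronskian vanished at z₀, some nontrivial combination would have zero initial values
there and so vanish near z₀, against linear independence. -/
lemma wronskian_ne_zero_of_isFundamentalSystem {w : Fin 2 → D.Torus → ℂ} {z₀ : ℂ}
    (hz₀ : z₀ ∉ D.singularSet) (hw : IsFundamentalSystem w (D.proj z₀)) {U : Set ℂ}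
    (hU : U ∈ 𝓝 z₀) (hUo : IsOpen U)
    (hu : ∀ k, SolvesLinear D.potential (fun z => w k (D.proj z)) U) :
    w 0 (D.proj z₀) * deriv (fun z => w 1 (D.proj z)) z₀ -
      deriv (fun z => w 0 (D.proj z)) z₀ * w 1 (D.proj z₀) ≠ 0 := by
  intro hW
  set u : Fin 2 → ℂ → ℂ := fun k z => w k (D.proj z) with hu_def
  let M : Matrix (Fin 2) (Fin 2) ℂ := !![u 0 z₀, u 1 z₀; deriv (u 0) z₀, deriv (u 1) z₀]
  have hdet : M.det = 0 := by
    rw [Matrix.det_fin_two_of, ← hW]; ring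
  obtain ⟨c, hc, hMc⟩ := Matrix.exists_mulVec_eq_zero_iff.mpr hdet
  have h0 := congrFun hMc 0
  have h1 := congrFun hMc 1
  simp only [M, Matrix.mulVec, dotProduct, Fin.sum_univ_two, Matrix.of_apply, Matrix.cons_val',
    Matrix.cons_val_zero, Matrix.cons_val_one, Pi.zero_apply, Matrix.cons_val_fin_one] at h0 h1
  have hlc := (hu 0).lincomb (hu 1) hUo (c 0) (c 1)
  have hmem := mem_of_mem_nhds hU
  have hz := hlc.eventually_eq_zero (analyticAt_potential hz₀) hU (by
    change c 0 * u 0 z₀ + c 1 * u 1 z₀ = 0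
    linear_combination h0) (by
    rw [((((hu 0).hasDerivAt hUo hmem).const_mul (c 0)).fun_add
      (((hu 1).hasDerivAt hUo hmem).const_mul (c 1))).deriv]
    linear_combination h1)
  refine hc (hw.2 c ?_)
  refine eventually_nhds_proj.mpr ?_
  filter_upwards [hz] with v hv
  rw [Fin.sum_univ_two]
  exact hv

namespace IsDivisorFunction

variable {Ψ : ℂ → ℂ} (hΨ : IsDivisorFunction D Ψ)
include hΨ

/-- A fundamental system extends to a basis of the space of entire good functions. -/
theorem exists_isGoodBasis (hlog : D.LogFree) {w : Fin 2 → D.Torus → ℂ} {z₀ s₀ : ℂ}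
    (hz₀ : z₀ ∉ D.singularSet) (hw : IsFundamentalSystem w (D.proj z₀)) (hs₀ : s₀ ^ 2 = Ψ z₀) :
    ∃ h, IsGoodBasis D Ψ h ∧ ∀ k, (fun z => w k (D.proj z)) =ᶠ[𝓝 z₀]
      fun z => h k z / sqrtBranch Ψ z₀ s₀ z := by
  obtain ⟨r, hr, hrs, hb⟩ := hΨ.exists_sqrt hz₀
  obtain ⟨hd, hsq, -⟩ := hb s₀ hs₀
  set τ := sqrtBranch Ψ z₀ s₀
  have hτ0 : ∀ z ∈ Metric.ball z₀ r, τ z ≠ 0 := fun z hz e =>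
    hΨ.ne_zero z (hrs z hz) (by rw [← hsq z, e]; ring)
  have hsol := fun k => (isSolutionNear_proj_iff hz₀).mp (hw.1 k)
  choose U hU hu using hsol
  obtain ⟨δ, hδ, hδb⟩ := Metric.mem_nhds_iff.mp
    (Filter.inter_mem (Filter.inter_mem (hU 0) (hU 1)) (Metric.ball_mem_nhds z₀ hr))
  have hu' : ∀ k, SolvesLinear D.potential (fun z => w k (D.proj z)) (Metric.ball z₀ δ) := by
    intro k
    refine (hu k).mono fun z hz => ?_
    fin_cases k
    · exact (hδb hz).1.1
    · exact (hδb hz).1.2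
  have hW := wronskian_ne_zero_of_isFundamentalSystem hz₀ hw (Metric.ball_mem_nhds z₀ hδ)
    Metric.isOpen_ball hu'
  -- The basis consists of the entire extensions of w k · τ. They span because H / τ is a
  -- combination of the w k near z₀, a relation which the identity theorem spreads over the plane.
  have hext : ∀ k, ∃ H, (∀ z, GoodAt D Ψ H z) ∧ H =ᶠ[𝓝 z₀] fun z => w k (D.proj z) * τ z :=
    fun k => hΨ.exists_entire_extension hlog (by
      filter_upwards [Metric.ball_mem_nhds z₀ hδ] with z hz
      exact hΨ.goodAt_mul Metric.isOpen_ball (fun z hz => hrs z (hδb hz).2)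
        (hd.mono fun z hz => (hδb hz).2) (fun z _ => hsq z) (hu' k) hz)
  choose h hg he using hext
  have hdiv : ∀ k, (fun z => w k (D.proj z)) =ᶠ[𝓝 z₀] fun z => h k z / τ z := by
    intro k
    filter_upwards [he k, Metric.ball_mem_nhds z₀ hr] with z hz hzr
    rw [hz, mul_div_cancel_right₀ _ (hτ0 z hzr)]
  refine ⟨h, ⟨hg, fun H hH => ?_, fun c hc => ?_⟩, hdiv⟩
  · obtain ⟨a, b, hab⟩ := (hΨ.solvesLinear_div (U := Metric.ball z₀ δ) Metric.isOpen_ball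
      (fun z hz => hrs z (hδb hz).2) (hd.mono fun z hz => (hδb hz).2) (fun z _ => hsq z)
      (fun z _ => hH z)).exists_eq_lincomb Metric.isOpen_ball (convex_ball _ _).isPreconnected
      (hu' 0) (hu' 1) (Metric.mem_ball_self hδ) hW
    refine ⟨![a, b], fun z => ?_⟩
    refine congrFun (AnalyticOnNhd.eq_of_eventuallyEq (fun z _ => (hH z).1)
      (g := fun z => ∑ k, ![a, b] k * h k z) (fun z _ =>
        Finset.analyticAt_fun_sum _ fun k _ => analyticAt_const.mul (hg k z).1)
      (z₀ := z₀) ?_) z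
    filter_upwards [Metric.ball_mem_nhds z₀ hδ, he 0, he 1] with z hz h0 h1
    have h2 := hab z hz
    rw [div_eq_iff (hτ0 z (hδb hz).2)] at h2
    simp only [Fin.sum_univ_two, Matrix.cons_val_zero, Matrix.cons_val_one,
      Matrix.cons_val_fin_one]
    rw [h2, h0, h1]
    ring
  · refine hw.2 c (eventually_nhds_proj.mpr ?_)
    filter_upwards [hdiv 0, hdiv 1] with z h0 h1
    have := hc z
    rw [Fin.sum_univ_two] at this ⊢
    rw [h0, h1]
    linear_combination (1 / τ z) * this

end IsDivisorFunction

/-- The translation by `l` acts on the basis `h` of the space of entire good functions, up to the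
multiplier `exp (a z + b)`, by the matrix `g`. -/
def ActsBy (Ψ : ℂ → ℂ) (h : Fin 2 → ℂ → ℂ) (l a b : ℂ) (g : GL (Fin 2) ℂ) : Prop :=
  (∀ z, Ψ (z + l) = Complex.exp (2 * (a * z + b)) * Ψ z) ∧
    ∀ j z, h j (z + l) = Complex.exp (a * z + b) * ∑ k, g.val k j * h k z

lemma ActsBy.zero (Ψ : ℂ → ℂ) (h : Fin 2 → ℂ → ℂ) : ActsBy Ψ h 0 0 0 1 := by
  refine ⟨fun z => by simp, fun j z => ?_⟩
  simp [Matrix.one_apply]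

/-- This is the sign ambiguity of the square root of the multiplier: adding πi to b leaves exp(2(az
+ b)) unchanged and negates exp(az + b). -/
lemma ActsBy.neg_matrix {Ψ : ℂ → ℂ} {h : Fin 2 → ℂ → ℂ} {l a b : ℂ} {g : GL (Fin 2) ℂ}
    (hg : ActsBy Ψ h l a b g) : ActsBy Ψ h l a (b + Real.pi * Complex.I) (-g) := by
  refine ⟨fun z => ?_, fun j z => ?_⟩
  · rw [hg.1, show 2 * (a * z + (b + Real.pi * Complex.I)) =
      2 * (a * z + b) + 2 * Real.pi * Complex.I by ring, Complex.exp_add (2 * (a * z + b)),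
      Complex.exp_two_pi_mul_I, mul_one]
  · rw [hg.2, ← add_assoc, Complex.exp_add (a * z + b), Complex.exp_pi_mul_I]
    simp [Fin.sum_univ_two]
    ring

/-- The term `a' * l` arises from evaluating the second multiplier at z + l. It is not symmetric in
the two translations, and this asymmetry produces the anticommutation. -/
lemma ActsBy.add {Ψ : ℂ → ℂ} {h : Fin 2 → ℂ → ℂ} {l a b l' a' b' : ℂ} {g g' : GL (Fin 2) ℂ}
    (hg : ActsBy Ψ h l a b g) (hg' : ActsBy Ψ h l' a' b' g') :
    ActsBy Ψ h (l + l') (a + a') (b + b' + a' * l) (g * g') := by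
  refine ⟨fun z => ?_, fun j z => ?_⟩
  · rw [← add_assoc, hg'.1, hg.1, ← mul_assoc, ← Complex.exp_add]
    congr 2; ring
  · rw [← add_assoc, hg'.2]
    simp only [hg.2, Units.val_mul, Matrix.mul_apply, Fin.sum_univ_two]
    rw [show (a + a') * z + (b + b' + a' * l) = (a' * (z + l) + b') + (a * z + b) by ring,
      Complex.exp_add (a' * (z + l) + b')]
    ring

lemma ActsBy.neg {Ψ : ℂ → ℂ} {h : Fin 2 → ℂ → ℂ} {l a b : ℂ} {g : GL (Fin 2) ℂ}
    (hg : ActsBy Ψ h l a b g) : ActsBy Ψ h (-l) (-a) (a * l - b) g⁻¹ := by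
  refine ⟨fun z => ?_, fun j z => ?_⟩
  · have := hg.1 (z + -l)
    rw [neg_add_cancel_right] at this
    rw [this, ← mul_assoc, ← Complex.exp_add]
    ring_nf
    simp
  · have h1 : ∀ i, h i z = Complex.exp (a * (z + -l) + b) * ∑ k, g.val k i * h k (z + -l) := by
      intro i
      rw [← hg.2 i, neg_add_cancel_right]
    have h2 : ∑ i, (g⁻¹).val i j * h i z =
        Complex.exp (a * (z + -l) + b) * ∑ k, (g.val * (g⁻¹).val) k j * h k (z + -l) := by
      simp only [h1, Matrix.mul_apply, Fin.sum_univ_two]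
      ring
    rw [h2, ← Units.val_mul, mul_inv_cancel, ← mul_assoc, ← Complex.exp_add]
    ring_nf
    simp [Matrix.one_apply]

namespace IsDivisorFunction

variable {Ψ : ℂ → ℂ} (hΨ : IsDivisorFunction D Ψ)
include hΨ

/-- Translation by l adds the constant 2a to the logarithmic derivative of Ψ and leaves the
potential unchanged; the factor exp(-(az + b)) compensates for this constant in the equation. -/
lemma goodAt_translate {l a b : ℂ} (hl : l ∈ D.L.lattice)
    (hab : ∀ z, Ψ (z + l) = Complex.exp (2 * (a * z + b)) * Ψ z) {H : ℂ → ℂ}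
    (hH : ∀ z, GoodAt D Ψ H z) (z : ℂ) :
    GoodAt D Ψ (fun z => Complex.exp (-(a * z + b)) * H (z + l)) z := by
  have hlin : ∀ c : ℂ, ∀ z, HasDerivAt (fun z => c * (a * z + b)) (c * a) z := fun c z => by
    simpa using (((hasDerivAt_id z).const_mul a).add_const b).const_mul c
  have hE : ∀ z, HasDerivAt (fun z => Complex.exp (-(a * z + b)))
      (-a * Complex.exp (-(a * z + b))) z := fun z => by
    have := (hlin (-1) z).cexp
    simp only [neg_one_mul] at this
    exact this.congr_deriv (by ring)
  have hH1 : ∀ z, HasDerivAt (fun z => H (z + l)) (deriv H (z + l)) z := fun z =>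
    ((hH (z + l)).1.differentiableAt.hasDerivAt).comp_add_const z l
  have hH2 : ∀ z, HasDerivAt (fun z => deriv H (z + l)) (deriv (deriv H) (z + l)) z := fun z =>
    ((hH (z + l)).1.deriv.differentiableAt.hasDerivAt).comp_add_const z l
  refine ⟨?_, fun hz => ?_⟩
  · refine Differentiable.analyticAt (fun z => ?_) z
    exact ((hE z).mul (hH1 z)).differentiableAt
  have hzl : z + l ∉ D.singularSet := fun h => hz ((add_mem_singularSet_iff hl).mp h)
  have hφ : ∀ w ∉ D.singularSet, logDeriv Ψ (w + l) = 2 * a + logDeriv Ψ w := by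
    intro w hw
    have h1 := (hΨ.differentiable (w + l)).hasDerivAt.comp_add_const w l
    rw [show (fun z => Ψ (z + l)) = _ from funext hab] at h1
    have h2 := ((hlin 2 w).cexp).mul (hΨ.differentiable w).hasDerivAt
    have h3 := h1.unique h2
    have h0 := hΨ.ne_zero w hw
    have h0' := Complex.exp_ne_zero (2 * (a * w + b))
    rw [logDeriv_apply, logDeriv_apply, h3, hab]
    field_simp
  have hφ' : deriv (logDeriv Ψ) (z + l) = deriv (logDeriv Ψ) z := by
    have h1 : (fun w => logDeriv Ψ (w + l)) =ᶠ[𝓝 z] fun w => 2 * a + logDeriv Ψ w := by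
      filter_upwards [isClosed_singularSet.isOpen_compl.mem_nhds hz] with w hw using hφ w hw
    rw [← deriv_comp_add_const, h1.deriv_eq, deriv_const_add]
  have hd1 : deriv (fun z => Complex.exp (-(a * z + b)) * H (z + l)) = fun z =>
      -a * Complex.exp (-(a * z + b)) * H (z + l) +
        Complex.exp (-(a * z + b)) * deriv H (z + l) :=
    funext fun z => ((hE z).fun_mul (hH1 z)).deriv
  have hd2 := ((((hE z).const_mul (-a)).fun_mul (hH1 z)).fun_add ((hE z).fun_mul (hH2 z))).deriv
  rw [hd1, hd2, (hH (z + l)).2 hzl, hφ z hz, hφ', potential_add hl hz]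
  ring

lemma exists_actsBy_of_multiplier {h : Fin 2 → ℂ → ℂ} (hh : IsGoodBasis D Ψ h) {l a b : ℂ}
    (hl : l ∈ D.L.lattice) (hab : ∀ z, Ψ (z + l) = Complex.exp (2 * (a * z + b)) * Ψ z) :
    ∃ g, ActsBy Ψ h l a b g := by
  have hsp := fun j => hh.span _ fun z => hΨ.goodAt_translate hl hab (hh.goodAt j) z
  choose c hc using hsp
  have hc' : ∀ j z, h j (z + l) = Complex.exp (a * z + b) * ∑ k, c j k * h k z := fun j z => by
    rw [← hc, ← mul_assoc, ← Complex.exp_add, add_neg_cancel, Complex.exp_zero, one_mul]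
  let M : Matrix (Fin 2) (Fin 2) ℂ := Matrix.of fun k j => c j k
  -- A kernel vector of the matrix gives a linear relation between the translated basis functions,
  -- hence between the basis functions themselves.
  have hdet : M.det ≠ 0 := by
    intro h0
    obtain ⟨v, hv, hMv⟩ := Matrix.exists_mulVec_eq_zero_iff.mpr h0
    refine hv (hh.indep v fun z => ?_)
    have h0 := congrFun hMv 0
    have h1 := congrFun hMv 1
    simp only [M, Matrix.mulVec, dotProduct, Fin.sum_univ_two, Matrix.of_apply,
      Pi.zero_apply] at h0 h1
    have e0 := hc' 0 (z - l)
    have e1 := hc' 1 (z - l)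
    rw [sub_add_cancel, Fin.sum_univ_two] at e0 e1
    rw [Fin.sum_univ_two, e0, e1]
    linear_combination Complex.exp (a * (z - l) + b) * (h 0 (z - l) * h0 + h 1 (z - l) * h1)
  exact ⟨Matrix.GeneralLinearGroup.mkOfDetNeZero M hdet, hab, hc'⟩

/-- The vectors l for which such a, b, g exist form a subgroup of ℂ, so the two periods suffice. -/
lemma exists_actsBy {h : Fin 2 → ℂ → ℂ} (hh : IsGoodBasis D Ψ h) {l : ℂ}
    (hl : l ∈ D.L.lattice) : ∃ a b g, ActsBy Ψ h l a b g := by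
  let S : AddSubgroup ℂ :=
    { carrier := {l | ∃ a b g, ActsBy Ψ h l a b g}
      add_mem' := fun ⟨a, b, g, hg⟩ ⟨a', b', g', hg'⟩ => ⟨_, _, _, hg.add hg'⟩
      zero_mem' := ⟨_, _, _, ActsBy.zero Ψ h⟩
      neg_mem' := fun ⟨a, b, g, hg⟩ => ⟨_, _, _, hg.neg⟩ }
  have hS : D.L.lattice ≤ AddSubgroup.toIntSubmodule S := by
    refine Submodule.span_le.mpr ?_
    rintro _ (rfl | rfl)
    · obtain ⟨g, hg⟩ := hΨ.exists_actsBy_of_multiplier hh (a := 0) (b := 0) D.L.ω₁_mem_lattice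
        (fun z => by simp [hΨ.add_first])
      exact ⟨0, 0, g, hg⟩
    · obtain ⟨a, b, -, hab⟩ := hΨ.add_second
      obtain ⟨g, hg⟩ := hΨ.exists_actsBy_of_multiplier hh (a := a / 2) (b := b / 2)
        D.L.ω₂_mem_lattice (fun z => by rw [hab]; congr 2; ring)
      exact ⟨_, _, g, hg⟩
  exact hS hl

/-- The matrix by which a translation acts is unique up to sign. -/
lemma eq_or_eq_neg_of_actsBy {h : Fin 2 → ℂ → ℂ} (hh : IsGoodBasis D Ψ h)
    {l a b a' b' : ℂ} {g g' : GL (Fin 2) ℂ} (hg : ActsBy Ψ h l a b g)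
    (hg' : ActsBy Ψ h l a' b' g') : g' = g ∨ g' = -g := by
  -- Both multipliers square to the multiplier of Ψ, so the square of their quotient is 1 off the
  -- singular set and, by density, everywhere. Differentiating gives a = a', and the constant
  -- quotient exp(b - b') is then ±1.
  have h1 : ∀ z, Complex.exp (2 * ((a - a') * z + (b - b'))) = 1 := by
    have hdense : Dense (D.singularSetᶜ) := countable_singularSet.dense_compl ℂ
    have hcont : Continuous fun z => Complex.exp (2 * ((a - a') * z + (b - b'))) := by fun_prop
    refine congrFun (Continuous.ext_on hdense hcont (g := fun _ => 1) continuous_const fun z hz => ?_)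
    have e := (hg.1 z).symm.trans (hg'.1 z)
    have e' := mul_right_cancel₀ (hΨ.ne_zero z hz) e
    rw [show 2 * ((a - a') * z + (b - b')) = 2 * (a * z + b) - 2 * (a' * z + b') by ring,
      Complex.exp_sub, e', div_self (Complex.exp_ne_zero _)]
  have ha : a = a' := by
    have hd : HasDerivAt (fun z => Complex.exp (2 * ((a - a') * z + (b - b'))))
        (Complex.exp (2 * ((a - a') * 0 + (b - b'))) * (2 * ((a - a') * 1))) 0 :=
      ((((hasDerivAt_id (0 : ℂ)).const_mul _).add_const _).const_mul 2).cexp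
    rw [show (fun z => Complex.exp (2 * ((a - a') * z + (b - b')))) = fun _ => 1 from funext h1]
      at hd
    have := hd.unique (hasDerivAt_const 0 1)
    simpa [Complex.exp_ne_zero, sub_eq_zero] using this
  subst ha
  have h2 : Complex.exp (b - b') ^ 2 = 1 := by
    have := h1 0
    rw [← this, ← Complex.exp_nat_mul]; congr 1; push_cast; ring
  have h3 : ∀ j k, g'.val k j = Complex.exp (b - b') * g.val k j := by
    intro j
    have := hh.indep (fun k => g'.val k j - Complex.exp (b - b') * g.val k j) fun z => by
      have e := (hg.2 j z).symm.trans (hg'.2 j z)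
      rw [show a * z + b = (a * z + b') + (b - b') by ring, Complex.exp_add (a * z + b'),
        mul_assoc] at e
      have e' := mul_left_cancel₀ (Complex.exp_ne_zero _) e
      rw [Fin.sum_univ_two] at e' ⊢
      rw [Fin.sum_univ_two] at e'
      linear_combination -e'
    intro k
    exact sub_eq_zero.mp (congrFun this k)
  rcases sq_eq_sq_iff_eq_or_eq_neg.mp (h2.trans (one_pow 2).symm) with e | e
  · left; ext k j; rw [h3, e, one_mul]
  · right; ext k j; rw [h3, e]; simp

/-- With one choice of roots of the multipliers, the two orders of composing the translations have
multipliers that differ by exp(αω₁/2) = exp(±πiℓ) = -1, as ℓ is odd. The functions h(z + ω₁ + ω₂)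
are the same, so the matrix products differ by a sign. Any other choice changes g or g' by a sign
only, which does not affect the relation. -/
lemma anticommute_of_actsBy (hodd : Odd (∑ i, D.ell i)) {h : Fin 2 → ℂ → ℂ}
    (hh : IsGoodBasis D Ψ h) {a b a' b' : ℂ} {g g' : GL (Fin 2) ℂ}
    (hg : ActsBy Ψ h D.L.ω₁ a b g) (hg' : ActsBy Ψ h D.L.ω₂ a' b' g') :
    g * g' = -(g' * g) := by
  obtain ⟨α, β, hα, hαβ⟩ := hΨ.add_second
  obtain ⟨τ, hτ⟩ := hΨ.exists_actsBy_of_multiplier hh (a := 0) (b := 0) D.L.ω₁_mem_lattice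
    (fun z => by simp [hΨ.add_first])
  obtain ⟨τ', hτ'⟩ := hΨ.exists_actsBy_of_multiplier hh (a := α / 2) (b := β / 2)
    D.L.ω₂_mem_lattice (fun z => by rw [hαβ]; congr 2; ring)
  have hexp : Complex.exp (α / 2 * D.L.ω₁) = -1 := by
    have hpow : Complex.exp ((∑ i, D.ell i : ℕ) * (Real.pi * Complex.I)) = -1 := by
      rw [Complex.exp_nat_mul, Complex.exp_pi_mul_I, hodd.neg_one_pow]
    rcases hα with e | e
    · rw [← hpow]; congr 1; linear_combination e / 2
    · have : α / 2 * D.L.ω₁ = -((∑ i, D.ell i : ℕ) * (Real.pi * Complex.I)) := by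
        linear_combination e / 2
      rw [this, Complex.exp_neg, hpow]; norm_num
  have key : τ * τ' = -(τ' * τ) := by
    have e1 := hτ.add hτ'
    have e2 := hτ'.add hτ
    rw [add_comm D.L.ω₂] at e2
    ext k j
    have := hh.indep (fun k => (τ * τ').val k j + (τ' * τ).val k j) fun z => by
      have e := (e1.2 j z).symm.trans (e2.2 j z)
      rw [show (0 + α / 2) * z + (0 + β / 2 + α / 2 * D.L.ω₁) =
        ((α / 2 + 0) * z + (β / 2 + 0 + 0 * D.L.ω₂)) + α / 2 * D.L.ω₁ by ring,
        Complex.exp_add ((α / 2 + 0) * z + _), hexp, mul_assoc] at e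
      have e' := mul_left_cancel₀ (Complex.exp_ne_zero _) e
      rw [Fin.sum_univ_two] at e' ⊢
      rw [Fin.sum_univ_two] at e'
      linear_combination -e'
    exact eq_neg_of_add_eq_zero_left (congrFun this k)
  rcases hΨ.eq_or_eq_neg_of_actsBy hh hτ hg with rfl | rfl <;>
  rcases hΨ.eq_or_eq_neg_of_actsBy hh hτ' hg' with rfl | rfl <;>
  simp [key]

end IsDivisorFunction

section Monodromy

lemma IsMonodromyMatrix.unique {x : D.PuncturedTorus} {w : Fin 2 → D.Torus → ℂ}
    (hw : IsFundamentalSystem w x.1) {γ : Path x x} {g g' : GL (Fin 2) ℂ}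
    (hg : IsMonodromyMatrix w γ g) (hg' : IsMonodromyMatrix w γ g') : g = g' := by
  ext k j
  obtain ⟨W, hW, h0, h1⟩ := hg j
  obtain ⟨W', hW', h0', h1'⟩ := hg' j
  have he := hW.eventuallyEq hW' (h0.trans h0'.symm)
  have := hw.2 (fun k => g.val k j - g'.val k j) (by
    filter_upwards [he, h1, h1'] with y e e1 e2
    rw [e, e2] at e1
    simp only [sub_mul, Finset.sum_sub_distrib, e1, sub_self])
  exact sub_eq_zero.mp (congrFun this k)

variable {Ψ : ℂ → ℂ} (hΨ : IsDivisorFunction D Ψ)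
include hΨ

/-- If a loop lifts to a path in the plane with displacement `l`, then its monodromy matrix
is a matrix by which the translation by `l` acts on the entire good functions. -/
theorem isMonodromyMatrix_of_actsBy {x : D.PuncturedTorus} {w : Fin 2 → D.Torus → ℂ}
    {h : Fin 2 → ℂ → ℂ} {z₀ s₀ : ℂ} (hh : IsGoodBasis D Ψ h) (hx : D.proj z₀ = x.1)
    (hwh : ∀ k, (fun z => w k (D.proj z)) =ᶠ[𝓝 z₀] fun z => h k z / sqrtBranch Ψ z₀ s₀ z)
    {γ : Path x x} {α s : I → ℂ} (hα : Continuous α) (hs : Continuous s)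
    (hαγ : ∀ t, D.proj (α t) = (γ t).1) (hsα : ∀ t, s t ^ 2 = Ψ (α t)) (hα0 : α 0 = z₀)
    (hs0 : s 0 = s₀) {l a b : ℂ} {g : GL (Fin 2) ℂ} (hα1 : α 1 = z₀ + l)
    (hg : ActsBy Ψ h l a b g) (hs1 : s 1 = Complex.exp (a * z₀ + b) * s₀) :
    IsMonodromyMatrix w γ g := by
  intro j
  have hz₀ : z₀ ∉ D.singularSet := notMem_singularSet_iff.mpr fun i => by rw [hx]; exact x.2 i
  have hl : l ∈ D.L.lattice := by
    have : D.proj (z₀ + l) = D.proj z₀ := by rw [← hα1, hαγ, γ.target, hx]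
    simpa using D.proj_eq_iff.mp this
  have hzl : z₀ + l ∉ D.singularSet := fun h => hz₀ ((add_mem_singularSet_iff hl).mp h)
  have hsq0 : s₀ ^ 2 = Ψ z₀ := by rw [← hs0, hsα, hα0]
  have hsq1 : s 1 ^ 2 = Ψ (z₀ + l) := by rw [hsα, hα1]
  obtain ⟨W, hW, hWα⟩ := hΨ.exists_isContinuation hα hs hαγ hsα (hh.goodAt j)
  have hW0 := hWα 0
  have hW1 := hWα 1
  rw [hα0, hs0] at hW0
  rw [hα1] at hW1
  refine ⟨W, hW, ?_, ?_⟩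
  · rw [← hx]
    exact eventually_nhds_proj.mpr (hW0.trans (hwh j).symm)
  · obtain ⟨r, hr, hrs, hb⟩ := hΨ.exists_sqrt hz₀
    obtain ⟨hd, hsq, hself⟩ := hb _ hsq0
    obtain ⟨r', hr', hrs', hb'⟩ := hΨ.exists_sqrt hzl
    obtain ⟨hd', hsq', hself'⟩ := hb' _ hsq1
    have hcont : Filter.Tendsto (fun z => z + l) (𝓝 z₀) (𝓝 (z₀ + l)) :=
      (continuous_add_const l).tendsto z₀
    -- Both sides are square roots of Ψ(z + l) that agree at z₀ by `hs1`. The factor exp(az + b)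
    -- then cancels between h and √Ψ, and only the matrix g remains.
    have hbranch : (fun z => sqrtBranch Ψ (z₀ + l) (s 1) (z + l)) =ᶠ[𝓝 z₀]
        fun z => Complex.exp (a * z + b) * sqrtBranch Ψ z₀ s₀ z := by
      refine eventuallyEq_of_sq_eq ?_ ?_ (.of_forall fun z => ?_) ?_ ?_
      · exact ContinuousAt.comp (g := sqrtBranch Ψ (z₀ + l) (s 1)) (f := fun z => z + l)
          (hd'.differentiableAt (Metric.ball_mem_nhds _ hr')).continuousAt (by fun_prop)
      · exact ContinuousAt.mul (by fun_prop)
          (hd.differentiableAt (Metric.ball_mem_nhds _ hr)).continuousAt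
      · rw [hsq', hg.1, mul_pow, hsq, ← Complex.exp_nat_mul]; push_cast; rfl
      · rw [hself', hself, hs1]
      · rw [hself']
        exact fun e => hΨ.ne_zero _ hzl (by rw [← hsq1, e]; ring)
    rw [← hx]
    refine eventually_nhds_proj.mpr ?_
    filter_upwards [hcont.eventually hW1, hbranch, hwh 0, hwh 1] with z e1 e2 e3 e4
    rw [D.proj_add hl] at e1
    have hexp := Complex.exp_ne_zero (a * z + b)
    rw [Fin.sum_univ_two, e3, e4, e1, e2, hg.2, Fin.sum_univ_two, mul_div_mul_left _ _ hexp]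
    ring

/-- Continuation of √Ψ along the lift ends at ±exp(a z₀ + b) s₀. In the case of the minus sign, the
triple (a, b, g) is replaced by (a, b + πi, -g). -/
theorem exists_isMonodromyMatrix {x : D.PuncturedTorus} {w : Fin 2 → D.Torus → ℂ}
    {h : Fin 2 → ℂ → ℂ} {z₀ s₀ : ℂ} (hh : IsGoodBasis D Ψ h) (hx : D.proj z₀ = x.1)
    (hs₀ : s₀ ^ 2 = Ψ z₀)
    (hwh : ∀ k, (fun z => w k (D.proj z)) =ᶠ[𝓝 z₀] fun z => h k z / sqrtBranch Ψ z₀ s₀ z)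
    {γ : Path x x} (α : C(I, ℂ)) (hαγ : ∀ t, D.proj (α t) = (γ t).1) (hα0 : α 0 = z₀) :
    ∃ a b g, IsMonodromyMatrix w γ g ∧ ActsBy Ψ h (α 1 - z₀) a b g := by
  have hreg : ∀ t, α t ∉ D.singularSet := fun t =>
    notMem_singularSet_iff.mpr fun i => by rw [hαγ]; exact (γ t).2 i
  have hl : α 1 - z₀ ∈ D.L.lattice := D.proj_eq_iff.mp (by rw [hαγ, γ.target, hx])
  obtain ⟨s, hs0, hs⟩ := exists_sqrt_path ((⟨Ψ, hΨ.differentiable.continuous⟩ : C(ℂ, ℂ)).comp α)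
    (fun t => hΨ.ne_zero _ (hreg t)) (s₀ := s₀) (by simp [hs₀, hα0])
  have hs' : ∀ t, s t ^ 2 = Ψ (α t) := hs
  obtain ⟨a, b, g, hg⟩ := hΨ.exists_actsBy hh hl
  have hsq : s 1 ^ 2 = (Complex.exp (a * z₀ + b) * s₀) ^ 2 := by
    have := hg.1 z₀
    rw [add_sub_cancel] at this
    rw [hs', this, mul_pow, hs₀, ← Complex.exp_nat_mul]; push_cast; rfl
  rcases sq_eq_sq_iff_eq_or_eq_neg.mp hsq with e | e
  · exact ⟨a, b, g, isMonodromyMatrix_of_actsBy hΨ hh hx hwh α.continuous s.continuous hαγ hs' hα0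
      hs0 (by ring) hg e, hg⟩
  · refine ⟨_, _, _, isMonodromyMatrix_of_actsBy hΨ hh hx hwh α.continuous s.continuous hαγ hs'
      hα0 hs0 (by ring) hg.neg_matrix ?_, hg.neg_matrix⟩
    rw [e, ← add_assoc, Complex.exp_add (a * z₀ + b), Complex.exp_pi_mul_I]
    ring

end Monodromy

end GeneralizedLame

end

/-! ### Klein four-groups, anticommuting matrices, and loops with prescribed lifts. -/

noncomputable section

/-- A subgroup generated by two distinct commuting involutions is a Klein four-group. -/
lemma Subgroup.isKleinFour_of_involutions {G : Type*} [Group G] (H : Subgroup G) {s t : G}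
    (hs : s ∈ H) (ht : t ∈ H) (hgen : ∀ g ∈ H, ∃ m n : ℤ, g = s ^ m * t ^ n) (hs2 : s ^ 2 = 1)
    (ht2 : t ^ 2 = 1) (hst : s * t = t * s) (hs1 : s ≠ 1) (ht1 : t ≠ 1) (hne : s ≠ t) :
    IsKleinFour H := by
  have hpow : ∀ a : G, a ^ 2 = 1 → ∀ m : ℤ, a ^ m = 1 ∨ a ^ m = a := by
    intro a ha m
    have ha' : a ^ (2 : ℤ) = 1 := by exact_mod_cast ha
    rcases Int.even_or_odd' m with ⟨k, rfl | rfl⟩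
    · left; rw [zpow_mul, ha', one_zpow]
    · right; rw [zpow_add, zpow_mul, ha', one_zpow, one_mul, zpow_one]
  have hmem : ∀ g ∈ H, g = 1 ∨ g = s ∨ g = t ∨ g = s * t := by
    intro g hg
    obtain ⟨m, n, rfl⟩ := hgen g hg
    rcases hpow s hs2 m with e | e <;> rcases hpow t ht2 n with e' | e' <;> simp [e, e']
  have hss : s * s = 1 := by rw [← sq, hs2]
  have htt : t * t = 1 := by rw [← sq, ht2]
  have hst1 : s * t ≠ 1 := fun h => hne (mul_right_cancel (h.trans htt.symm))
  have hcard : Nat.card H = 4 := by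
    have hH : (H : Set G) = {1, s, t, s * t} := by
      ext g
      simp only [SetLike.mem_coe, Set.mem_insert_iff, Set.mem_singleton_iff]
      refine ⟨hmem g, ?_⟩
      rintro (rfl | rfl | rfl | rfl)
      exacts [one_mem _, hs, ht, mul_mem hs ht]
    have : (H : Set G).ncard = 4 := by
      classical
      rw [hH]
      rw [Set.ncard_insert_of_notMem, Set.ncard_insert_of_notMem, Set.ncard_pair]
      all_goals simp [hs1, ht1, hne, hs1.symm, ht1.symm, hst1.symm]
    exact this
  refine ⟨hcard, ?_⟩
  have hdvd : Monoid.exponent H ∣ 2 := by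
    refine Monoid.exponent_dvd_of_forall_pow_eq_one fun g => Subtype.ext ?_
    rw [Subgroup.coe_pow, Subgroup.coe_one]
    rcases hmem g g.2 with e | e | e | e
    · rw [e, one_pow]
    · rw [e, hs2]
    · rw [e, ht2]
    · rw [e, sq, mul_assoc, ← mul_assoc t, ← hst, mul_assoc, htt, mul_one, hss]
  rcases (Nat.dvd_prime Nat.prime_two).mp hdvd with e | e
  · rw [Monoid.exp_eq_one_iff] at e
    exact absurd (congrArg Subtype.val (Subsingleton.elim (⟨s, hs⟩ : H) 1)) hs1
  · exact e

/-- A two-by-two matrix which anticommutes with an invertible matrix has scalar square. -/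
lemma Matrix.GeneralLinearGroup.sq_eq_scalar_of_anticommute {g h : GL (Fin 2) ℂ}
    (hgh : g * h = -(h * g)) : g ^ 2 = Matrix.GeneralLinearGroup.scalar (Fin 2) (-g.det) := by
  -- g is conjugate to -g, so its trace is zero, and Cayley–Hamilton reduces to g² = -det g.
  have h1 : g.val = -(h.val * g.val * (h⁻¹).val) := by
    have : g = -(h * g) * h⁻¹ := by rw [← hgh, mul_inv_cancel_right]
    have := congrArg Units.val this
    simpa using this
  have htr : g.val.trace = 0 := by
    have h2 : (h.val * g.val * (h⁻¹).val).trace = g.val.trace := by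
      rw [Matrix.trace_mul_cycle, ← Units.val_mul, inv_mul_cancel, Units.val_one, one_mul]
    have h3 := congrArg Matrix.trace h1
    rw [Matrix.trace_neg, h2] at h3
    exact CharZero.eq_neg_self_iff.mp h3
  rw [Matrix.trace_fin_two] at htr
  ext i j
  have hd := Matrix.det_fin_two g.val
  fin_cases i <;> fin_cases j <;>
    simp [sq, Matrix.mul_apply, Fin.sum_univ_two, Matrix.scalar_apply, hd] <;>
    first
    | linear_combination g.val 0 0 * htr
    | linear_combination g.val 0 1 * htr
    | linear_combination g.val 1 0 * htr
    | linear_combination g.val 1 1 * htr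

namespace GeneralizedLame

variable {D : GeneralizedLame}

lemma ActsBy.zpow {Ψ : ℂ → ℂ} {h : Fin 2 → ℂ → ℂ} {l a b : ℂ} {g : GL (Fin 2) ℂ}
    (hg : ActsBy Ψ h l a b g) (n : ℤ) : ∃ a' b', ActsBy Ψ h (n * l) a' b' (g ^ n) := by
  induction n using Int.induction_on with
  | zero => exact ⟨0, 0, by simpa using ActsBy.zero Ψ h⟩
  | succ n ih =>
    obtain ⟨a', b', ih⟩ := ih
    have := ih.add hg
    rw [← zpow_add_one] at this
    exact ⟨_, _, by push_cast at this ⊢; rw [add_mul, one_mul]; exact this⟩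
  | pred n ih =>
    obtain ⟨a', b', ih⟩ := ih
    have := ih.add hg.neg
    rw [← zpow_sub_one] at this
    exact ⟨_, _, by push_cast at this ⊢; rw [sub_mul, one_mul, sub_eq_add_neg]; exact this⟩

lemma mk_neg (g : GL (Fin 2) ℂ) :
    (Matrix.ProjGenLinGroup.mk (-g) : PGL(2, ℂ)) = Matrix.ProjGenLinGroup.mk g := by
  rw [eq_comm, Matrix.ProjGenLinGroup.mk_eq_mk_iff]
  exact ⟨-1, by ext i j; fin_cases i <;> fin_cases j <;> simp [Matrix.mul_apply]⟩

/-- Every lattice vector is the displacement of a lift of a loop in the punctured torus. -/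
lemma exists_loop {x : D.PuncturedTorus} {z₀ l : ℂ} (hx : D.proj z₀ = x.1)
    (hl : l ∈ D.L.lattice) :
    ∃ (γ : Path x x) (α : C(I, ℂ)), (∀ t, D.proj (α t) = (γ t).1) ∧ α 0 = z₀ ∧ α 1 = z₀ + l := by
  have hz₀ : z₀ ∉ D.singularSet := notMem_singularSet_iff.mpr fun i => by rw [hx]; exact x.2 i
  -- The singular set is countable, so its complement in the plane is path connected; a path in it
  -- from z₀ to z₀ + l projects to the loop.
  have hpc : IsPathConnected (D.singularSetᶜ) :=
    countable_singularSet.isPathConnected_compl_of_one_lt_rank (by simp)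
  obtain ⟨α, hα⟩ := hpc.joinedIn z₀ hz₀ (z₀ + l)
    (fun h => hz₀ ((add_mem_singularSet_iff hl).mp h))
  refine ⟨⟨⟨fun t => ⟨D.proj (α t), notMem_singularSet_iff.mp (hα t)⟩, ?_⟩, ?_, ?_⟩, α,
    fun t => rfl, α.source, α.target⟩
  · exact (D.continuous_proj.comp α.continuous).subtype_mk _
  · exact Subtype.ext (by simp [hx])
  · exact Subtype.ext (by simp [D.proj_add hl, hx])

section SmallCircle

/-- Concatenation of paths preserves a pointwise relation. -/
lemma path_trans_rel {X Y : Type*} [TopologicalSpace X] [TopologicalSpace Y] {a b c : X}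
    {a' b' c' : Y} {Q : X → Y → Prop} {p : Path a b} {q : Path b c} {p' : Path a' b'}
    {q' : Path b' c'} (hp : ∀ t, Q (p t) (p' t)) (hq : ∀ t, Q (q t) (q' t)) (t : I) :
    Q (p.trans q t) (p'.trans q' t) := by
  rw [Path.trans_apply, Path.trans_apply]
  split_ifs
  · exact hp _
  · exact hq _

variable {Ψ : ℂ → ℂ} (hΨ : IsDivisorFunction D Ψ)
include hΨ

/-- Along a small circle around a singular point of strength `ℓ`, the square root of `Ψ` changes by
the factor `(-1) ^ ℓ`. -/
lemma exists_sqrt_circle {i : Fin D.N} {l : ℂ} (hl : l ∈ D.L.lattice) {r : ℝ} (hr : 0 < r)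
    (hball : ∀ z ∈ Metric.closedBall (D.p i) r, z ∈ D.singularSet → z = D.p i) :
    ∃ s : I → ℂ, Continuous s ∧ s 1 = (-1) ^ D.ell i * s 0 ∧ ∀ t : I, s t ^ 2 =
      Ψ (D.p i + l + r * Complex.exp (2 * Real.pi * Complex.I * (t : ℝ))) := by
  obtain ⟨G, hG, hfac, hG0⟩ := hΨ.factor i (D.p i + l) (by simpa)
  -- `R` maps ℂ into the closed disc of radius r around pᵢ + l, on which G has no zeros. So G ∘ R
  -- has a continuous square root on the simply connected plane.
  let R : C(ℂ, ℂ) := ⟨fun u => D.p i + l + r * (u / (max 1 ‖u‖ : ℝ)), by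
    refine continuous_const.add (continuous_const.mul (continuous_id.div ?_ fun u => ?_))
    · exact Complex.continuous_ofReal.comp (continuous_const.max continuous_norm)
    · exact_mod_cast (zero_lt_one.trans_le (le_max_left 1 ‖u‖)).ne'⟩
  have hR : ∀ u, G (R u) ≠ 0 := by
    intro u h0
    obtain ⟨h1, h2⟩ := hG0 _ h0
    have hpos : 0 < max 1 ‖u‖ := zero_lt_one.trans_le (le_max_left 1 ‖u‖)
    have h3 : R u - l ∈ Metric.closedBall (D.p i) r := by
      have : R u - l - D.p i = r * (u / (max 1 ‖u‖ : ℝ)) := by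
        simp only [R, ContinuousMap.coe_mk]; ring
      rw [Metric.mem_closedBall, dist_eq_norm, this, norm_mul, norm_div, Complex.norm_real,
        Complex.norm_real, Real.norm_of_nonneg hr.le, Real.norm_of_nonneg hpos.le]
      exact mul_le_of_le_one_right hr.le ((div_le_one hpos).mpr (le_max_right _ _))
    have h4 : R u - l ∈ D.singularSet := by
      rw [← add_mem_singularSet_iff hl, sub_add_cancel]; exact h1
    exact h2 (by rw [← hball _ h3 h4]; ring)
  obtain ⟨κ₀, hκ₀⟩ := IsAlgClosed.exists_pow_nat_eq (G (R 0)) two_pos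
  obtain ⟨κ, -, hκ⟩ := exists_sqrt_lift ((⟨G, hG.continuous⟩ : C(ℂ, ℂ)).comp R) hR hκ₀
  obtain ⟨ρ, hρ⟩ := IsAlgClosed.exists_pow_nat_eq (r : ℂ) two_pos
  -- On the circle z - z₀ = ρ² exp(2πit), with root ρ exp(πit), whose ℓ-th power acquires (-1) ^ ℓ;
  -- the factor κ returns to its initial value.
  refine ⟨fun t => (ρ * Complex.exp (Real.pi * Complex.I * (t : ℝ))) ^ D.ell i *
    κ (Complex.exp (2 * Real.pi * Complex.I * (t : ℝ))), by fun_prop, ?_, fun t => ?_⟩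
  · simp [Complex.exp_pi_mul_I, Complex.exp_two_pi_mul_I]
    ring
  · have hn : ‖Complex.exp (2 * Real.pi * Complex.I * (t : ℝ))‖ = 1 := by
      rw [show (2 * Real.pi * Complex.I * (t : ℝ) : ℂ) = ((2 * Real.pi * t : ℝ) : ℂ) * Complex.I by
        push_cast; ring, Complex.norm_exp_ofReal_mul_I]
    have hRe : R (Complex.exp (2 * Real.pi * Complex.I * (t : ℝ))) =
        D.p i + l + r * Complex.exp (2 * Real.pi * Complex.I * (t : ℝ)) := by
      simp only [R, ContinuousMap.coe_mk, hn, max_self, Complex.ofReal_one, div_one]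
    have hκ' : κ (Complex.exp (2 * Real.pi * Complex.I * (t : ℝ))) ^ 2 =
        G (R (Complex.exp (2 * Real.pi * Complex.I * (t : ℝ)))) := hκ _
    rw [mul_pow, hκ', hRe, ← pow_mul, mul_comm (D.ell i), pow_mul, mul_pow, hρ,
      ← Complex.exp_nat_mul, hfac, add_sub_cancel_left]
    congr 4
    push_cast; ring

/-- The loop lifts to a closed path, along which √Ψ acquires ε = (-1) ^ ℓᵢ. This is the case l = 0,
a = 0, b = ℓᵢπi, in which exp(b) = ε and the matrix ε cancels in the action on h. -/
theorem isMonodromyMatrix_smallCircle {x : D.PuncturedTorus} {w : Fin 2 → D.Torus → ℂ}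
    {h : Fin 2 → ℂ → ℂ} {z₀ s₀ : ℂ} (hh : IsGoodBasis D Ψ h) (hx : D.proj z₀ = x.1)
    (hs₀ : s₀ ^ 2 = Ψ z₀)
    (hwh : ∀ k, (fun z => w k (D.proj z)) =ᶠ[𝓝 z₀] fun z => h k z / sqrtBranch Ψ z₀ s₀ z)
    {i : Fin D.N} {y : D.PuncturedTorus} {c : Path y y} (hc : IsSmallCircle i c) (δ : Path x y) :
    IsMonodromyMatrix w ((δ.trans c).trans δ.symm) ((-1) ^ D.ell i) := by
  obtain ⟨r, hr, hball, hcirc⟩ := hc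
  obtain ⟨α, hα0, hα⟩ := exists_lift δ hx
  have hreg : ∀ t, α t ∉ D.singularSet := fun t =>
    notMem_singularSet_iff.mpr fun i => by rw [hα]; exact (δ t).2 i
  obtain ⟨s, hs0, hs⟩ := exists_sqrt_path ((⟨Ψ, hΨ.differentiable.continuous⟩ : C(ℂ, ℂ)).comp α)
    (fun t => hΨ.ne_zero _ (hreg t)) (s₀ := s₀) (by simp [hs₀, hα0])
  have hs' : ∀ t, s t ^ 2 = Ψ (α t) := hs
  -- The lift of δ ends at the start of a circle around a translate of pᵢ; this is the translation
  -- vector.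
  set l := α 1 - (D.p i + r) with hl
  have hll : l ∈ D.L.lattice := by
    refine D.proj_eq_iff.mp ?_
    have := hcirc 0
    rw [c.source] at this
    rw [hα, δ.target, this]
    simp
  obtain ⟨k, hkc, hk1, hk⟩ := exists_sqrt_circle hΨ hll hr hball
  have hcirc' : ∀ t : I, D.proj (D.p i + l + r * Complex.exp (2 * Real.pi * Complex.I * (t : ℝ))) =
      (c t).1 := fun t => by
    rw [hcirc, add_right_comm, D.proj_add hll]
  have hα1 : D.p i + l + r = α 1 := by rw [hl]; ring
  have hk0 : k 0 ^ 2 = s 1 ^ 2 := by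
    rw [hk, hs', ← hα1]; simp
  have hs1 : s 1 ≠ 0 := fun e => hΨ.ne_zero _ (hreg 1) (by rw [← hs', e]; ring)
  have hk00 : k 0 ≠ 0 := fun e => hs1 (pow_eq_zero_iff two_ne_zero |>.mp (by rw [← hk0, e]; ring))
  have hratio : (s 1 / k 0) ^ 2 = 1 := by
    rw [div_pow, ← hk0, div_self (pow_ne_zero 2 hk00)]
  set ε : ℂ := (-1) ^ D.ell i with hε
  have hε2 : ε ^ 2 = 1 := by rw [hε, ← pow_mul, mul_comm, pow_mul]; norm_num
  -- Paths in ℂ × ℂ record the lifted point together with the root of Ψ. On the circle the root is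
  -- rescaled by s 1 / k 0 = ±1 to match the end of `P₁`; the way back carries the factor ε.
  let P₁ : Path (z₀, s₀) (α 1, s 1) :=
    ⟨⟨fun t => (α t, s t), by fun_prop⟩, by simp [hα0, hs0], rfl⟩
  let P₂ : Path (α 1, s 1) (α 1, ε * s 1) :=
    ⟨⟨fun t => (D.p i + l + r * Complex.exp (2 * Real.pi * Complex.I * (t : ℝ)), s 1 / k 0 * k t),
      by fun_prop⟩, by
        refine Prod.ext ?_ ?_
        · simp [← hα1]
        · change s 1 / k 0 * k 0 = s 1
          field_simp, by
        refine Prod.ext ?_ ?_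
        · simp [← hα1, Complex.exp_two_pi_mul_I]
        · change s 1 / k 0 * k 1 = ε * s 1
          rw [hk1]; field_simp⟩
  let P₃ : Path (α 1, ε * s 1) (z₀, ε * s₀) :=
    ⟨⟨fun t => (α (σ t), ε * s (σ t)), by fun_prop⟩, by simp, by simp [hα0, hs0]⟩
  let Q : ℂ × ℂ → D.PuncturedTorus → Prop := fun u v => D.proj u.1 = v.1 ∧ u.2 ^ 2 = Ψ u.1
  have hQ := path_trans_rel (Q := Q) (p := P₁.trans P₂) (q := P₃) (p' := δ.trans c) (q' := δ.symm)
    (path_trans_rel (fun t => ⟨hα t, hs' t⟩) (fun t => ⟨hcirc' t, by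
      change (s 1 / k 0 * k t) ^ 2 = _
      rw [mul_pow, hratio, one_mul, hk]; rfl⟩))
    (fun t => ⟨hα (σ t), by
      change (ε * s (σ t)) ^ 2 = _
      rw [mul_pow, hε2, one_mul, hs']; rfl⟩)
  set P := (P₁.trans P₂).trans P₃
  have hexp : Complex.exp ((0 : ℂ) * z₀ + D.ell i * (Real.pi * Complex.I)) = ε := by
    rw [zero_mul, zero_add, Complex.exp_nat_mul, Complex.exp_pi_mul_I]
  refine isMonodromyMatrix_of_actsBy hΨ hh hx hwh (α := fun t => (P t).1) (s := fun t => (P t).2)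
    (by fun_prop) (by fun_prop) (fun t => (hQ t).1) (fun t => (hQ t).2) (by simp) (by simp)
    (l := 0) (a := 0) (b := D.ell i * (Real.pi * Complex.I)) (by simp) ⟨fun z => ?_, fun j z => ?_⟩
    (by rw [hexp]; simp)
  · rw [zero_mul, zero_add, ← mul_assoc, mul_comm 2, mul_assoc, Complex.exp_nat_mul,
      ← mul_assoc, Complex.exp_two_pi_mul_I]
    simp
  · rw [zero_mul, zero_add, Complex.exp_nat_mul, Complex.exp_pi_mul_I, add_zero]
    rcases Nat.even_or_odd (D.ell i) with e | e <;> rw [e.neg_one_pow, e.neg_one_pow] <;>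
      fin_cases j <;> simp [Fin.sum_univ_two]

end SmallCircle

end GeneralizedLame

end

/-! ### The theorem. -/

theorem mainTheorem3 (D : GeneralizedLame) (hodd : Odd (∑ i, D.ell i)) (hlog : D.LogFree)
    (x : D.PuncturedTorus) (w : Fin 2 → D.Torus → ℂ)
    (hw : GeneralizedLame.IsFundamentalSystem w x.1) :
    -- monodromy is defined along every loop
    (∀ γ : Path x x, ∃! g : GL (Fin 2) ℂ, GeneralizedLame.IsMonodromyMatrix w γ g) ∧
    -- the local monodromies are `(-1) ^ ℓᵢ`
    (∀ (i : Fin D.N) (y : D.PuncturedTorus) (c : Path y y),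
      GeneralizedLame.IsSmallCircle i c → ∀ δ : Path x y,
        GeneralizedLame.IsMonodromyMatrix w ((δ.trans c).trans δ.symm) ((-1) ^ D.ell i)) ∧
    -- the monodromies along the two periods anticommute
    (∀ (γ₁ γ₂ : Path x x) (S₁ S₂ : GL (Fin 2) ℂ),
      GeneralizedLame.RepresentsPeriod γ₁ D.L.ω₁ → GeneralizedLame.RepresentsPeriod γ₂ D.L.ω₂ →
      GeneralizedLame.IsMonodromyMatrix w γ₁ S₁ → GeneralizedLame.IsMonodromyMatrix w γ₂ S₂ →
        S₁ * S₂ = -(S₂ * S₁)) ∧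
    -- the projective monodromy group is the Klein four-group
    Nonempty (GeneralizedLame.projectiveMonodromyGroup x w ≃*
      Multiplicative (ZMod 2) × Multiplicative (ZMod 2)) := by
  obtain ⟨Ψ, hΨ⟩ := GeneralizedLame.exists_isDivisorFunction D
  obtain ⟨z₀, hz⟩ := D.surjective_proj x.1
  have hz₀ : z₀ ∉ D.singularSet :=
    GeneralizedLame.notMem_singularSet_iff.mpr fun i => by rw [hz]; exact x.2 i
  obtain ⟨s₀, hs₀⟩ := IsAlgClosed.exists_pow_nat_eq (Ψ z₀) two_pos
  obtain ⟨h, hh, hwh⟩ := hΨ.exists_isGoodBasis hlog hz₀ (by rwa [hz]) hs₀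
  have hacts : ∀ {γ : Path x x} {g : GL (Fin 2) ℂ} {α : C(I, ℂ)} {l : ℂ},
      GeneralizedLame.IsMonodromyMatrix w γ g → (∀ t, D.proj (α t) = (γ t).1) → α 0 = z₀ →
      α 1 = z₀ + l → ∃ a b, GeneralizedLame.ActsBy Ψ h l a b g := by
    intro γ g α l hg hαγ hα0 hα1
    obtain ⟨a, b, g', hg', hact⟩ :=
      GeneralizedLame.exists_isMonodromyMatrix hΨ hh hz hs₀ hwh α hαγ hα0
    rw [hα1, add_sub_cancel_left, hg'.unique hw hg] at hact
    exact ⟨a, b, hact⟩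
  have hperiod : ∀ {γ : Path x x} {g : GL (Fin 2) ℂ} {l : ℂ},
      GeneralizedLame.RepresentsPeriod γ l → GeneralizedLame.IsMonodromyMatrix w γ g →
      ∃ a b, GeneralizedLame.ActsBy Ψ h l a b g := by
    rintro γ g l ⟨α, hα, hα1⟩ hg
    -- The given lift may start at another point over x; a lattice translation moves its start to z₀
    -- without changing the displacement.
    have hmem : z₀ - α 0 ∈ D.L.lattice := D.proj_eq_iff.mp (by rw [hz, hα, γ.source])
    refine hacts (α := ⟨fun t => α t + (z₀ - α 0), by fun_prop⟩) hg (fun t => ?_) ?_ ?_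
    · exact (D.proj_add hmem).trans (hα t)
    · exact add_sub_cancel _ _
    · change α 1 + (z₀ - α 0) = _
      rw [hα1]; ring
  have hexists : ∀ γ : Path x x, ∃ g, GeneralizedLame.IsMonodromyMatrix w γ g := by
    intro γ
    obtain ⟨α, hα0, hα⟩ := GeneralizedLame.exists_lift γ hz
    obtain ⟨-, -, g, hg, -⟩ :=
      GeneralizedLame.exists_isMonodromyMatrix hΨ hh hz hs₀ hwh α hα hα0
    exact ⟨g, hg⟩
  have hanti : ∀ (γ₁ γ₂ : Path x x) (S₁ S₂ : GL (Fin 2) ℂ),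
      GeneralizedLame.RepresentsPeriod γ₁ D.L.ω₁ → GeneralizedLame.RepresentsPeriod γ₂ D.L.ω₂ →
      GeneralizedLame.IsMonodromyMatrix w γ₁ S₁ → GeneralizedLame.IsMonodromyMatrix w γ₂ S₂ →
        S₁ * S₂ = -(S₂ * S₁) := by
    intro γ₁ γ₂ S₁ S₂ h₁ h₂ hS₁ hS₂
    obtain ⟨a, b, hg⟩ := hperiod h₁ hS₁
    obtain ⟨a', b', hg'⟩ := hperiod h₂ hS₂
    exact hΨ.anticommute_of_actsBy hodd hh hg hg'
  refine ⟨fun γ => ?_, fun i y c hc δ => ?_, hanti, ?_⟩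
  · obtain ⟨g, hg⟩ := hexists γ
    exact ⟨g, hg, fun g' hg' => hg'.unique hw hg⟩
  · exact GeneralizedLame.isMonodromyMatrix_smallCircle hΨ hh hz hs₀ hwh hc δ
  obtain ⟨γ₁, α₁, hα₁, hα₁0, hα₁1⟩ := GeneralizedLame.exists_loop hz D.L.ω₁_mem_lattice
  obtain ⟨γ₂, α₂, hα₂, hα₂0, hα₂1⟩ := GeneralizedLame.exists_loop hz D.L.ω₂_mem_lattice
  obtain ⟨S, hS⟩ := hexists γ₁
  obtain ⟨T, hT⟩ := hexists γ₂
  obtain ⟨a₁, b₁, hSact⟩ := hacts hS hα₁ hα₁0 hα₁1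
  obtain ⟨a₂, b₂, hTact⟩ := hacts hT hα₂ hα₂0 hα₂1
  have hST : S * T = -(T * S) := hΨ.anticommute_of_actsBy hodd hh hSact hTact
  have hTS : T * S = -(S * T) := by rw [hST, neg_neg]
  have hnc : S * T ≠ T * S := by
    intro e
    rw [e] at hST
    refine (T * S).ne_zero (Matrix.ext fun i j => CharZero.eq_neg_self_iff.mp ?_)
    exact congrArg (fun g : GL (Fin 2) ℂ => g.val i j) hST
  -- Each element of M, not only each generator, acts as some lattice translation.
  have hgroup : ∀ g ∈ GeneralizedLame.monodromyGroup x w,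
      ∃ l ∈ D.L.lattice, ∃ a b, GeneralizedLame.ActsBy Ψ h l a b g := by
    intro g hg
    induction hg using Subgroup.closure_induction with
    | mem g hg =>
      obtain ⟨γ, hg⟩ := hg
      obtain ⟨α, hα0, hα⟩ := GeneralizedLame.exists_lift γ hz
      exact ⟨α 1 - z₀, D.proj_eq_iff.mp (by rw [hα, γ.target, hz]),
        hacts hg hα hα0 (add_sub_cancel _ _).symm⟩
    | one => exact ⟨0, zero_mem _, _, _, GeneralizedLame.ActsBy.zero Ψ h⟩
    | mul g g' _ _ ih ih' =>
      obtain ⟨l, hl, a, b, hg⟩ := ih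
      obtain ⟨l', hl', a', b', hg'⟩ := ih'
      exact ⟨_, add_mem hl hl', _, _, hg.add hg'⟩
    | inv g _ ih =>
      obtain ⟨l, hl, a, b, hg⟩ := ih
      exact ⟨_, neg_mem hl, _, _, hg.neg⟩
  -- Matrices with the same class in PGL differ by a central factor, hence have the same commutants.
  have hcenter : ∀ {g g' : GL (Fin 2) ℂ},
      (Matrix.ProjGenLinGroup.mk g : PGL(2, ℂ)) = Matrix.ProjGenLinGroup.mk g' →
      ∀ k : GL (Fin 2) ℂ, Commute g' k → Commute g k := by
    intro g g' e k hk
    rw [← div_eq_one, ← map_div, Matrix.ProjGenLinGroup.mk_eq_one] at e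
    have h1 : Commute (g / g') k := (Subgroup.mem_center_iff.mp e k).symm
    simpa using h1.mul_left hk
  have : IsKleinFour (GeneralizedLame.projectiveMonodromyGroup x w) := by
    refine Subgroup.isKleinFour_of_involutions _
      (s := Matrix.ProjGenLinGroup.mk S) (t := Matrix.ProjGenLinGroup.mk T)
      (Subgroup.mem_map_of_mem _ (Subgroup.subset_closure ⟨γ₁, hS⟩))
      (Subgroup.mem_map_of_mem _ (Subgroup.subset_closure ⟨γ₂, hT⟩)) ?_ ?_ ?_ ?_ ?_ ?_ ?_
    · rintro _ ⟨g, hg, rfl⟩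
      obtain ⟨l, hl, a, b, hact⟩ := hgroup g hg
      obtain ⟨m, n, rfl⟩ := D.L.mem_lattice.mp hl
      obtain ⟨a', b', hm⟩ := hSact.zpow m
      obtain ⟨a'', b'', hn⟩ := hTact.zpow n
      refine ⟨m, n, ?_⟩
      rw [← map_zpow, ← map_zpow, ← map_mul]
      -- The matrices g and SᵐTⁿ act by the same vector mω₁ + nω₂, so they agree up to sign.
      rcases hΨ.eq_or_eq_neg_of_actsBy hh (hm.add hn) hact with e | e
      · rw [e]
      · rw [e, GeneralizedLame.mk_neg]
    · rw [← map_pow, Matrix.GeneralLinearGroup.sq_eq_scalar_of_anticommute hST,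
        Matrix.ProjGenLinGroup.mk_scalar]
    · rw [← map_pow, Matrix.GeneralLinearGroup.sq_eq_scalar_of_anticommute hTS,
        Matrix.ProjGenLinGroup.mk_scalar]
    · rw [← map_mul, ← map_mul, hST, GeneralizedLame.mk_neg]
    -- If S or T were trivial in PGL, or if their classes coincided, then S and T would commute.
    · exact fun e => hnc (hcenter (e.trans (map_one _).symm) T (Commute.one_left T))
    · exact fun e => hnc (hcenter (e.trans (map_one _).symm) S (Commute.one_left S)).symm
    · exact fun e => hnc (hcenter e T (Commute.refl T))
  obtain ⟨e⟩ := IsKleinFour.nonempty_mulEquiv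
    (G₁ := GeneralizedLame.projectiveMonodromyGroup x w) (G₂ := Multiplicative (ZMod 2 × ZMod 2))
  exact ⟨e.trans (MulEquiv.prodMultiplicative _ _)⟩
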